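/- Let $G$ be a finite simple connected graph of order $n\ge 4$ with exactly $p$ pendant vertices (vertices of degree $1$), where $1\le p\le n-2$. Let $N(G)$ denote the number of connected induced subgraphs of $G$, that is, the number of nonempty vertex sets $S\subseteq V(G)$ such that the subgraph of $G$ induced by $S$ is connected. Write $P_m$ and $S_m$ for the path and the star with $m$ vertices, and $K_3$ for the triangle. (1) If $p=1$, then $$N(G)\ \ge\ \frac{n^2+3n-4}{2},$$ with equality if and only if $G$ is isomorphic to the graph obtained from disjoint copies of $K_3$ and $P_{n-2}$ by identifying a vertex of $K_3$ with a leaf of $P_{n-2}$. (2) If $p\neq 1$, then $$N(G)\ \ge\ 2^p+(n-p-1)\bigl(2^{\lfloor p/2\rfloor}+2^{\lceil p/2\rceil}\bigr)+p+\frac{(n-p-1)(n-p-2)}{2},$$ with equality if and only if $G$ is isomorphic to the tree $\mathbb T^1(n,p)$ obtained from disjoint copies of $S_{1+\lfloor p/2\rfloor}$, $S_{1+\lceil p/2\rceil}$ and $P_{n-p}$ by identifying the central vertices of the two stars with the two leaves of $P_{n-p}$, respectively (for a star with two vertices, either vertex may be taken as central). -/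

import Mathlib

/-- The number `N(G)` of connected induced subgraphs of `G`, i.e. the number of vertex sets `S`
such that the subgraph of `G` induced by `S` is connected
(in Mathlib a connected graph is nonempty, so `S` is nonempty). -/
noncomputable def numConnInduced {V : Type*} (G : SimpleGraph V) : ℕ :=
  {S : Set V | (G.induce S).Connected}.ncard

/-- The number of pendant vertices (vertices of degree `1`) of `G`. -/
def numPendant {V : Type*} [Fintype V] (G : SimpleGraph V) [DecidableRel G.Adj] : ℕ :=
  (Finset.univ.filter fun v => G.degree v = 1).card

/-- The graph obtained from disjoint copies of `G` and `H` by identifying the vertex `u` of `G`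
with the vertex `v` of `H`. The merged vertex is represented by `Sum.inl u`. -/
def identifyVertices {V W : Type*} (G : SimpleGraph V) (u : V) (H : SimpleGraph W) (v : W) :
    SimpleGraph (V ⊕ {w : W // w ≠ v}) where
  Adj
    | .inl a, .inl b => G.Adj a b
    | .inl a, .inr y => a = u ∧ H.Adj v y
    | .inr x, .inl b => b = u ∧ H.Adj v x
    | .inr x, .inr y => H.Adj x y
  symm := ⟨by
    rintro (a | x) (b | y) h
    · exact SimpleGraph.Adj.symm h
    · exact h
    · exact h
    · exact SimpleGraph.Adj.symm h⟩
  loopless := ⟨by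
    rintro (a | x) h
    · exact G.irrefl h
    · exact H.irrefl h⟩

/-- The star on `1 + k` vertices; its central vertex is `0`. -/
abbrev starOn (k : ℕ) : SimpleGraph (Fin (k + 1)) := SimpleGraph.starGraph 0

/-- The graph obtained by identifying a leaf of the path `P_{n-2}` with a vertex of `K_3`. -/
abbrev trianglePath (n : ℕ) (h : 3 ≤ n) :=
  identifyVertices (SimpleGraph.pathGraph (n - 2)) ⟨0, by omega⟩
    (⊤ : SimpleGraph (Fin 3)) 0

/-- The tree `𝕋¹(n, p)`: the two leaves (end vertices) of the path `P_{n-p}` are identified with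
the central vertices of the stars on `1 + ⌊p/2⌋` and `1 + ⌈p/2⌉` vertices, respectively. -/
abbrev treeT1 (n p : ℕ) (h : p + 2 ≤ n) :=
  identifyVertices
    (identifyVertices (SimpleGraph.pathGraph (n - p)) ⟨0, by omega⟩ (starOn (p / 2)) 0)
    (Sum.inl ⟨n - p - 1, by omega⟩) (starOn ((p + 1) / 2)) 0

/-!
Connected induced subgraphs are counted as connected vertex sets `A`. Connectedness is used in the
form "every proper nonempty part of `A` sends an edge to the rest of `A`" (`isConn_iff`). It implies
that a connected set grows vertex by vertex inside a larger one, so that a connected set `S` has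
non-cut vertices, and that a connected set with `m` vertices has at least `m (m + 1) / 2` connected
subsets, with equality only for paths (`card_mul_succ_le_card_connSets`,
`exists_isNumbering_pathRel`).

*Several pendant vertices.* The vertices that are not pendant form a connected set `S`; let `w x` be
the number of pendant vertices at `x`. A connected set is a single pendant vertex, or a connected
subset `B` of `S` with any of the `w(B)` pendant vertices attached to it. Hence the count is
`p + ∑ 2 ^ w(B)` (`card_connSets_of_pendant`). The set `S` contributes `2 ^ p` to the sum.
If `m = |S|`, there are at least `m - 1` partitions of `S` into two connected sets
(`two_mul_card_le_card_splits`). The weights of the two parts add up to `p`, so by convexity they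
contribute at least `2 ^ ⌊p/2⌋ + 2 ^ ⌈p/2⌉` together. Each of the other connected subsets of `S`
contributes at least `1`. As `S` has at least `m (m + 1) / 2` connected subsets, this adds up to the
bound (`le_two_mul_wSum`). In the case of equality `S` is a path, its inner vertices, which are not
parts of connected partitions, have weight zero, and the weights of its ends are balanced.

*One pendant vertex.* Let `S` be the complement of the pendant vertex and `r ∈ S` its neighbour. All
vertices of `S` other than `r` have two neighbours in `S`. The count is one more than the number of
connected subsets of `S` plus the number of those containing `r`, and this sum is bounded by
induction on `|S|` (`card_connSets_add_card_connSetsAt`). If `r` is a leaf of `S`, it is removed.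
Otherwise all vertices of `S` have two neighbours in `S` and so lie in at least `2 |S| - 2` connected
sets (`two_mul_card_le_card_connSetsAt`), which gives a strict inequality unless `S` is a triangle.
-/

/-! ### Connected vertex sets -/

namespace ConnInduced

variable {V : Type*} {G : SimpleGraph V}

/-- The finite vertex set `A` induces a connected (in particular nonempty) subgraph of `G`. -/
def IsConn (G : SimpleGraph V) (A : Finset V) : Prop := (G.induce (A : Set V)).Connected

/-- Connectedness in terms of cuts: every proper nonempty part of `A` is joined to the rest of `A`
by an edge. This is the form in which connectedness is used below. -/
theorem isConn_iff {A : Finset V} :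
    IsConn G A ↔ A.Nonempty ∧
      ∀ B ⊆ A, B.Nonempty → B ≠ A → ∃ u ∈ B, ∃ v ∈ A, v ∉ B ∧ G.Adj u v := by
  classical
  constructor
  · intro h
    obtain ⟨⟨a, ha⟩⟩ := h.nonempty
    refine ⟨⟨a, ha⟩, fun B hBA ⟨b, hb⟩ hne => ?_⟩
    by_contra! hcon
    obtain ⟨c, hcA, hcB⟩ := Finset.exists_of_ssubset (hBA.ssubset_of_ne hne)
    obtain ⟨W⟩ := h.preconnected ⟨b, hBA hb⟩ ⟨c, hcA⟩
    have key : ∀ (x y : (A : Set V)) (_ : (G.induce (A : Set V)).Walk x y),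
        (x : V) ∈ B → (y : V) ∈ B := by
      intro x y W
      induction W with
      | nil => exact id
      | @cons x z y hxz _ ih =>
        intro hx
        refine ih (by_contra fun hz => hcon x hx z z.2 hz hxz)
    exact hcB (key _ _ W hb)
  · rintro ⟨⟨a, ha⟩, h⟩
    rw [IsConn, SimpleGraph.connected_iff_exists_forall_reachable]
    refine ⟨⟨a, ha⟩, ?_⟩
    by_contra! hcon
    obtain ⟨⟨c, hc⟩, hac⟩ := hcon
    set B := A.filter fun x =>
      ∃ hx : x ∈ (A : Set V), (G.induce (A : Set V)).Reachable ⟨a, ha⟩ ⟨x, hx⟩ with hB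
    obtain ⟨u, hu, v, hv, hvB, huv⟩ := h B (Finset.filter_subset _ _)
      ⟨a, by simpa [hB] using ha⟩ (by
        intro hBA
        have : c ∈ B := hBA ▸ hc
        rw [hB, Finset.mem_filter] at this
        exact hac this.2.2)
    rw [hB, Finset.mem_filter] at hu hvB
    obtain ⟨hu1, hu2, hu3⟩ := hu
    refine hvB ⟨hv, hv, hu3.trans (SimpleGraph.Adj.reachable ?_)⟩
    exact huv

theorem IsConn.nonempty {A : Finset V} (h : IsConn G A) : A.Nonempty := (isConn_iff.1 h).1

theorem IsConn.exists_adj {A B : Finset V} (h : IsConn G A) (hBA : B ⊆ A) (hB : B.Nonempty)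
    (hne : B ≠ A) : ∃ u ∈ B, ∃ v ∈ A, v ∉ B ∧ G.Adj u v :=
  (isConn_iff.1 h).2 B hBA hB hne

theorem isConn_singleton (x : V) : IsConn G {x} := by
  refine isConn_iff.2 ⟨Finset.singleton_nonempty x, fun B hB hne h => ?_⟩
  rcases Finset.subset_singleton_iff.1 hB with h' | h'
  · simp [h'] at hne
  · exact absurd h' h

theorem isConn_univ [Fintype V] (h : G.Connected) : IsConn G Finset.univ := by
  rw [IsConn, Finset.coe_univ]
  exact (SimpleGraph.induceUnivIso G).connected_iff.2 h

section Cuts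

variable [DecidableEq V]

theorem IsConn.insert {A : Finset V} (h : IsConn G A) {x y : V} (hx : x ∈ A) (hxy : G.Adj x y) :
    IsConn G (insert y A) := by
  by_cases hy : y ∈ A
  · rwa [Finset.insert_eq_self.2 hy]
  refine isConn_iff.2 ⟨Finset.insert_nonempty _ _, fun B hB hne hBA => ?_⟩
  by_cases hAB : A ⊆ B
  · refine ⟨x, hAB hx, y, Finset.mem_insert_self _ _, fun hyB => hBA ?_, hxy⟩
    exact hB.antisymm (Finset.insert_subset hyB hAB)
  by_cases hBA' : (B ∩ A).Nonempty
  · obtain ⟨u, hu, v, hv, hvB, huv⟩ := h.exists_adj Finset.inter_subset_right hBA'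
      (fun h' => hAB (h' ▸ Finset.inter_subset_left))
    simp only [Finset.mem_inter, not_and] at hu hvB
    exact ⟨u, hu.1, v, Finset.mem_insert_of_mem hv, fun h' => hvB h' hv, huv⟩
  · have hBy : ∀ z ∈ B, z = y := fun z hz => by
      rcases Finset.mem_insert.1 (hB hz) with h' | h'
      · exact h'
      · exact absurd ⟨z, Finset.mem_inter.2 ⟨hz, h'⟩⟩ hBA'
    obtain ⟨z, hz⟩ := hne
    have hzy := hBy z hz
    subst hzy
    exact ⟨z, hz, x, Finset.mem_insert_of_mem hx, fun hxB => hy (hBy x hxB ▸ hx), hxy.symm⟩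

theorem isConn_pair {x y : V} (h : G.Adj x y) : IsConn G {x, y} := by
  rw [Finset.pair_comm]
  exact (isConn_singleton x).insert (Finset.mem_singleton_self x) h

/-- Deleting a vertex with at most one neighbour in `A` keeps `A` connected. -/
theorem IsConn.erase_leaf {A : Finset V} (h : IsConn G A) {r s : V}
    (hr : ∀ x ∈ A, G.Adj r x → x = s) (hne : (A.erase r).Nonempty) : IsConn G (A.erase r) := by
  refine isConn_iff.2 ⟨hne, fun B hB hBne hBA => ?_⟩
  have hrB : r ∉ B := fun h' => Finset.notMem_erase r A (hB h')
  have hBA' : B ⊆ A := hB.trans (Finset.erase_subset _ _)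
  by_cases hrA : r ∈ A
  swap
  · rw [Finset.erase_eq_of_notMem hrA] at hBA ⊢
    exact h.exists_adj hBA' hBne hBA
  by_cases hs : s ∈ B
  · obtain ⟨u, hu, v, hv, hvB, huv⟩ := h.exists_adj (B := Insert.insert r B)
      (Finset.insert_subset hrA hBA') (Finset.insert_nonempty _ _) (by
        rintro rfl
        simp [Finset.erase_insert hrB] at hBA)
    rw [Finset.mem_insert, not_or] at hvB
    rcases Finset.mem_insert.1 hu with rfl | hu
    · exact absurd (hr v hv huv ▸ hs) hvB.2
    · exact ⟨u, hu, v, Finset.mem_erase.2 ⟨hvB.1, hv⟩, hvB.2, huv⟩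
  · obtain ⟨u, hu, v, hv, hvB, huv⟩ := h.exists_adj hBA' hBne (fun h' => hrB (h' ▸ hrA))
    refine ⟨u, hu, v, Finset.mem_erase.2 ⟨?_, hv⟩, hvB, huv⟩
    rintro rfl
    exact hs (hr u (hBA' hu) huv.symm ▸ hu)

/-- A connected subset of a connected set grows, vertex by vertex, through connected sets. -/
theorem IsConn.exists_between {S A : Finset V} (hS : IsConn G S) (hA : IsConn G A) (hAS : A ⊆ S)
    {k : ℕ} (hk : A.card ≤ k) (hkS : k ≤ S.card) :
    ∃ B, A ⊆ B ∧ B ⊆ S ∧ IsConn G B ∧ B.card = k := by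
  induction k, hk using Nat.le_induction with
  | base => exact ⟨A, subset_rfl, hAS, hA, rfl⟩
  | succ k hk ih =>
    obtain ⟨B, hAB, hBS, hB, hBk⟩ := ih (by omega)
    obtain ⟨u, hu, v, hv, hvB, huv⟩ := hS.exists_adj hBS hB.nonempty (by rintro rfl; omega)
    exact ⟨Insert.insert v B, hAB.trans (Finset.subset_insert _ _), Finset.insert_subset hv hBS,
      hB.insert hu huv, by rw [Finset.card_insert_of_notMem hvB, hBk]⟩

/-- A proper connected subset avoids some non-cut vertex. -/
theorem IsConn.exists_isConn_erase {S A : Finset V} (hS : IsConn G S) (hA : IsConn G A)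
    (hAS : A ⊆ S) (hne : A ≠ S) : ∃ v ∈ S, v ∉ A ∧ IsConn G (S.erase v) := by
  have hlt : A.card < S.card := Finset.card_lt_card (hAS.ssubset_of_ne hne)
  obtain ⟨B, hAB, hBS, hB, hBk⟩ := hS.exists_between hA hAS (k := S.card - 1) (by omega) (by omega)
  obtain ⟨v, hv, hvB⟩ := Finset.exists_of_ssubset
    (hBS.ssubset_of_ne (by rintro rfl; omega))
  refine ⟨v, hv, fun h => hvB (hAB h), ?_⟩
  rwa [← Finset.eq_of_subset_of_card_le (Finset.subset_erase.2 ⟨hBS, hvB⟩)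
    (by rw [Finset.card_erase_of_mem hv, hBk])]

theorem IsConn.exists_adj_mem {S : Finset V} (hS : IsConn G S) {v : V} (hv : v ∈ S)
    (h2 : 2 ≤ S.card) : ∃ x ∈ S.erase v, G.Adj v x := by
  obtain ⟨u, hu, x, hx, hxu, h⟩ := hS.exists_adj (Finset.singleton_subset_iff.2 hv)
    (Finset.singleton_nonempty v) (by rintro rfl; simp at h2)
  rw [Finset.mem_singleton] at hu hxu
  subst hu
  exact ⟨x, Finset.mem_erase.2 ⟨hxu, hx⟩, h⟩

end Cuts

/-! ### Weighted counts of connected sets -/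

open Classical in
/-- The connected subsets of `S`. -/
noncomputable def connSets (G : SimpleGraph V) (S : Finset V) : Finset (Finset V) :=
  {A ∈ S.powerset | IsConn G A}

/-- The sum of `2 ^ w(A)` over the connected subsets `A` of `S`, where `w(A)` is the sum of the
vertex weights in `A`. -/
noncomputable def wSum (G : SimpleGraph V) (w : V → ℕ) (S : Finset V) : ℕ :=
  ∑ A ∈ connSets G S, 2 ^ ∑ x ∈ A, w x

variable {S : Finset V} {r s : V}

@[simp] theorem mem_connSets {A : Finset V} : A ∈ connSets G S ↔ A ⊆ S ∧ IsConn G A := by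
  simp [connSets]

theorem wSum_zero : wSum G 0 S = (connSets G S).card := by simp [wSum]

theorem connSets_singleton (r : V) : connSets G {r} = {{r}} := by
  ext A
  simp only [mem_connSets, Finset.mem_singleton]
  constructor
  · rintro ⟨h, hA⟩
    exact (Finset.subset_singleton_iff.1 h).resolve_left hA.nonempty.ne_empty
  · rintro rfl
    exact ⟨subset_rfl, isConn_singleton _⟩

variable [DecidableEq V]

/-- The connected subsets of `S` that contain `r`. -/
noncomputable def connSetsAt (G : SimpleGraph V) (r : V) (S : Finset V) : Finset (Finset V) :=
  {A ∈ connSets G S | r ∈ A}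

/-- The part of `wSum` that comes from the connected sets containing `r`. -/
noncomputable def wSumAt (G : SimpleGraph V) (w : V → ℕ) (r : V) (S : Finset V) : ℕ :=
  ∑ A ∈ connSetsAt G r S, 2 ^ ∑ x ∈ A, w x

@[simp] theorem mem_connSetsAt {A : Finset V} :
    A ∈ connSetsAt G r S ↔ A ⊆ S ∧ IsConn G A ∧ r ∈ A := by
  simp [connSetsAt, and_assoc]

theorem wSumAt_zero : wSumAt G 0 r S = (connSetsAt G r S).card := by simp [wSumAt]

theorem wSum_eq_erase_add (w : V → ℕ) (v : V) :
    wSum G w S = wSum G w (S.erase v) + wSumAt G w v S := by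
  classical
  rw [wSum, wSumAt, connSetsAt, ← Finset.sum_filter_add_sum_filter_not (connSets G S) (v ∈ ·),
    add_comm]
  congr 1
  refine Finset.sum_congr ?_ fun _ _ => rfl
  ext A
  simp [Finset.subset_erase, and_right_comm]

theorem card_connSets_eq_erase_add (v : V) :
    (connSets G S).card = (connSets G (S.erase v)).card + (connSetsAt G v S).card := by
  simpa only [wSum_zero, wSumAt_zero] using wSum_eq_erase_add (G := G) (S := S) 0 v

/-- If `s` is the only neighbour of `r` in `S`, a connected set containing `r` is `{r}` or arises
from a connected set containing `s` by adding `r`. -/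
theorem wSumAt_leaf (w : V → ℕ) (hr : r ∈ S) (hs : s ∈ S) (hrs : G.Adj r s)
    (hleaf : ∀ x ∈ S, G.Adj r x → x = s) :
    wSumAt G w r S = 2 ^ w r * (1 + wSumAt G w s (S.erase r)) := by
  have himg : connSetsAt G r S =
      insert {r} ((connSetsAt G s (S.erase r)).image (insert r)) := by
    ext A
    simp only [mem_connSetsAt, Finset.mem_insert, Finset.mem_image, Finset.subset_erase]
    constructor
    · rintro ⟨hAS, hA, hrA⟩
      by_cases hne : A = {r}
      · exact Or.inl hne
      have h2 : 2 ≤ A.card := by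
        by_contra hlt
        have h1 : A.card ≤ 1 := by omega
        exact hne (Finset.eq_singleton_iff_unique_mem.2
          ⟨hrA, fun x hx => Finset.card_le_one.1 h1 x hx r hrA⟩)
      obtain ⟨x, hx, hrx⟩ := hA.exists_adj_mem hrA h2
      have hxs := hleaf x (hAS (Finset.mem_of_mem_erase hx)) hrx
      subst hxs
      exact Or.inr ⟨A.erase r, ⟨⟨(Finset.erase_subset _ _).trans hAS, Finset.notMem_erase _ _⟩,
        hA.erase_leaf (fun y hy => hleaf y (hAS hy)) ⟨x, hx⟩, hx⟩, Finset.insert_erase hrA⟩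
    · rintro (rfl | ⟨B, ⟨⟨hBS, -⟩, hB, hsB⟩, rfl⟩)
      · exact ⟨Finset.singleton_subset_iff.2 hr, isConn_singleton _, Finset.mem_singleton_self _⟩
      · exact ⟨Finset.insert_subset hr hBS, hB.insert hsB hrs.symm, Finset.mem_insert_self _ _⟩
  have hnot : ∀ B ∈ connSetsAt G s (S.erase r), r ∉ B := fun B hB h =>
    Finset.notMem_erase r S ((mem_connSetsAt.1 hB).1 h)
  rw [wSumAt, himg, Finset.sum_insert, Finset.sum_image, mul_add, wSumAt, Finset.mul_sum]
  · congr 1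
    · simp
    · refine Finset.sum_congr rfl fun B hB => ?_
      rw [Finset.sum_insert (hnot B hB), pow_add]
  · intro B hB C hC h
    rw [← Finset.erase_insert (hnot B hB), h, Finset.erase_insert (hnot C hC)]
  · intro h
    obtain ⟨B, hB, h⟩ := Finset.mem_image.1 h
    have : s ∈ ({r} : Finset V) := h ▸ Finset.mem_insert_of_mem (mem_connSetsAt.1 hB).2.2
    exact hrs.ne (Finset.mem_singleton.1 this).symm

theorem card_connSetsAt_leaf (hr : r ∈ S) (hs : s ∈ S) (hrs : G.Adj r s)
    (hleaf : ∀ x ∈ S, G.Adj r x → x = s) :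
    (connSetsAt G r S).card = 1 + (connSetsAt G s (S.erase r)).card := by
  simpa [wSumAt_zero] using wSumAt_leaf (G := G) 0 hr hs hrs hleaf

theorem connSetsAt_singleton (r : V) : connSetsAt G r {r} = {{r}} := by
  ext A
  have := Finset.ext_iff.1 (connSets_singleton (G := G) r) A
  rw [mem_connSets] at this
  rw [mem_connSetsAt, ← and_assoc, this, Finset.mem_singleton, and_iff_left_iff_imp]
  rintro rfl
  exact Finset.mem_singleton_self _

end ConnInduced

/-! ### Lower bounds for the number of connected sets -/

namespace ConnInduced

variable {V : Type*} {G : SimpleGraph V} [DecidableEq V] {S : Finset V} {r : V}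

theorem card_sub_le_card_supersets {A : Finset V} (hS : IsConn G S) (hA : IsConn G A)
    (hAS : A ⊆ S) : S.card + 1 ≤ {B ∈ connSets G S | A ⊆ B}.card + A.card := by
  have h : ∀ k ∈ Finset.range (S.card + 1 - A.card),
      ∃ B, A ⊆ B ∧ B ⊆ S ∧ IsConn G B ∧ B.card = A.card + k := fun k hk =>
    hS.exists_between hA hAS (by omega) (by have := Finset.mem_range.1 hk; omega)
  choose! B hB using h
  have := Finset.card_le_card_of_injOn (t := {B ∈ connSets G S | A ⊆ B}) B
    (fun k hk => by
      obtain ⟨h1, h2, h3, -⟩ := hB k hk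
      simp [h1, h2, h3])
    (fun k hk l hl hkl => by
      have h1 := (hB k hk).2.2.2
      have h2 := (hB l hl).2.2.2
      rw [hkl] at h1
      omega)
  rw [Finset.card_range] at this
  omega

theorem card_le_card_connSetsAt (hS : IsConn G S) (hr : r ∈ S) :
    S.card ≤ (connSetsAt G r S).card := by
  have h := card_sub_le_card_supersets hS (isConn_singleton r) (Finset.singleton_subset_iff.2 hr)
  simpa [Finset.singleton_subset_iff, connSetsAt] using h

/-- A vertex `r` with two neighbours lies together with any other vertex `v` in a connected proper
subset. -/
theorem exists_isConn_ne_of_two_adj (hS : IsConn G S) (hr : r ∈ S) {v a b : V} (hv : v ∈ S)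
    (hvr : v ≠ r) (ha : a ∈ S) (hb : b ∈ S) (hab : a ≠ b) (hra : G.Adj r a) (hrb : G.Adj r b) :
    ∃ B ⊆ S, IsConn G B ∧ r ∈ B ∧ v ∈ B ∧ B ≠ S := by
  -- `C` is the connected component of `v` in `S \ {r}`.
  obtain ⟨C, hCmem, hmax⟩ := Finset.exists_max_image (connSetsAt G v (S.erase r)) Finset.card
    ⟨{v}, by simp [isConn_singleton, hv, hvr]⟩
  obtain ⟨hCS, hC, hvC⟩ := mem_connSetsAt.1 hCmem
  obtain ⟨hCS', hrC⟩ := Finset.subset_erase.1 hCS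
  obtain ⟨u, hu, x, hx, hxC, hux⟩ :=
    hS.exists_adj hCS' hC.nonempty (fun h => hrC (h ▸ hr))
  have hxr : x = r := by
    by_contra hxr
    have := hmax (insert x C) (mem_connSetsAt.2
      ⟨Finset.insert_subset (Finset.mem_erase.2 ⟨hxr, hx⟩) hCS, hC.insert hu hux,
        Finset.mem_insert_of_mem hvC⟩)
    rw [Finset.card_insert_of_notMem hxC] at this
    omega
  subst hxr
  by_cases hne : insert x C = S
  swap
  · exact ⟨insert x C, Finset.insert_subset hr hCS', hC.insert hu hux,
      Finset.mem_insert_self _ _, Finset.mem_insert_of_mem hvC, hne⟩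
  have haC : a ∈ C := (Finset.mem_insert.1 (hne ▸ ha)).resolve_left hra.ne.symm
  have hbC : b ∈ C := (Finset.mem_insert.1 (hne ▸ hb)).resolve_left hrb.ne.symm
  -- Here `r` is not a cut vertex; drop a non-cut vertex `z` of `C`, which leaves `a` or `b`.
  obtain ⟨z, hz, hzv, hCz⟩ := hC.exists_isConn_erase (isConn_singleton v)
    (Finset.singleton_subset_iff.2 hvC) (by
      rintro rfl
      exact hab ((Finset.mem_singleton.1 haC).trans (Finset.mem_singleton.1 hbC).symm))
  rw [Finset.mem_singleton] at hzv
  obtain ⟨c, hc, hcx⟩ : ∃ c ∈ C.erase z, G.Adj c x := by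
    by_cases haz : a = z
    · exact ⟨b, Finset.mem_erase.2 ⟨fun h => hab (haz.trans h.symm), hbC⟩, hrb.symm⟩
    · exact ⟨a, Finset.mem_erase.2 ⟨haz, haC⟩, hra.symm⟩
  refine ⟨insert x (C.erase z), Finset.insert_subset hr ((Finset.erase_subset _ _).trans hCS'),
    hCz.insert hc hcx, Finset.mem_insert_self _ _,
    Finset.mem_insert_of_mem (Finset.mem_erase.2 ⟨fun h => hzv h.symm, hvC⟩), fun h => ?_⟩
  have hzS : z ∈ insert x (C.erase z) := h ▸ hCS' hz
  rcases Finset.mem_insert.1 hzS with h' | h'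
  · exact hxC (h' ▸ hz)
  · exact Finset.notMem_erase _ _ h'

/-- If `r` has two neighbours in the connected set `S`, then `r` lies in at least `2 |S| - 2`
connected subsets of `S`. -/
theorem two_mul_card_le_card_connSetsAt (hS : IsConn G S) (hr : r ∈ S) {a b : V} (ha : a ∈ S)
    (hb : b ∈ S) (hab : a ≠ b) (hra : G.Adj r a) (hrb : G.Adj r b) :
    2 * S.card ≤ (connSetsAt G r S).card + 2 := by
  induction hm : S.card generalizing S with
  | zero => omega
  | succ m ih =>
  have hA : IsConn G {b, r, a} :=
    (isConn_pair hra).insert (Finset.mem_insert_self _ _) hrb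
  have hAS : {b, r, a} ⊆ S := by
    simp only [Finset.insert_subset_iff, Finset.singleton_subset_iff]
    exact ⟨hb, hr, ha⟩
  by_cases hne : {b, r, a} = S
  · -- The sets `{r}`, `{r, b}` and at least two supersets of `{r, a}`.
    have h3 : S.card = 3 := by
      rw [← hne, Finset.card_eq_three]
      exact ⟨b, r, a, hrb.ne.symm, hab.symm, hra.ne, rfl⟩
    have h2 := card_sub_le_card_supersets hS (isConn_pair hra)
      (Finset.insert_subset hr (Finset.singleton_subset_iff.2 ha))
    rw [Finset.card_pair hra.ne] at h2
    have hsub : insert {r} (insert {r, b} {B ∈ connSets G S | {r, a} ⊆ B}) ⊆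
        connSetsAt G r S := by
      intro B hB
      simp only [Finset.mem_insert, Finset.mem_filter, mem_connSets, Finset.insert_subset_iff,
        Finset.singleton_subset_iff] at hB
      rw [mem_connSetsAt]
      rcases hB with rfl | rfl | ⟨⟨h1, h2⟩, h3, -⟩
      · exact ⟨Finset.singleton_subset_iff.2 hr, isConn_singleton _, Finset.mem_singleton_self _⟩
      · exact ⟨Finset.insert_subset hr (Finset.singleton_subset_iff.2 hb), isConn_pair hrb,
          Finset.mem_insert_self _ _⟩
      · exact ⟨h1, h2, h3⟩
    have hcard := Finset.card_le_card hsub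
    rw [Finset.card_insert_of_notMem, Finset.card_insert_of_notMem] at hcard
    · omega
    · simp [Finset.insert_subset_iff, hra.ne.symm, hab]
    · rw [Finset.mem_insert, not_or]
      constructor
      · intro h
        have : b ∈ ({r} : Finset V) := h ▸ by simp
        exact hrb.ne (Finset.mem_singleton.1 this).symm
      · simp [Finset.insert_subset_iff, hra.ne.symm]
  · obtain ⟨v, hv, hvA, hSv⟩ := hS.exists_isConn_erase hA hAS hne
    simp only [Finset.mem_insert, Finset.mem_singleton, not_or] at hvA
    have hih := ih hSv (Finset.mem_erase.2 ⟨Ne.symm hvA.2.1, hr⟩)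
      (Finset.mem_erase.2 ⟨Ne.symm hvA.2.2, ha⟩) (Finset.mem_erase.2 ⟨Ne.symm hvA.1, hb⟩)
      (by rw [Finset.card_erase_of_mem hv]; omega)
    obtain ⟨B, hBS, hB, hrB, hvB, hBne⟩ :=
      exists_isConn_ne_of_two_adj hS hr hv hvA.2.1 ha hb hab hra hrb
    have hsub : insert S (insert B (connSetsAt G r (S.erase v))) ⊆ connSetsAt G r S := by
      intro C hC
      simp only [Finset.mem_insert, mem_connSetsAt] at hC ⊢
      rcases hC with rfl | rfl | ⟨h1, h2⟩
      · exact ⟨subset_rfl, hS, hr⟩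
      · exact ⟨hBS, hB, hrB⟩
      · exact ⟨h1.trans (Finset.erase_subset _ _), h2⟩
    have hcard := Finset.card_le_card hsub
    rw [Finset.card_insert_of_notMem, Finset.card_insert_of_notMem] at hcard
    · omega
    · intro h
      exact Finset.notMem_erase v S ((mem_connSetsAt.1 h).1 hvB)
    · rw [Finset.mem_insert, not_or]
      exact ⟨hBne.symm, fun h => Finset.notMem_erase v S ((mem_connSetsAt.1 h).1 hv)⟩

/-- A connected set on `m` vertices has at least as many connected subsets as a path. -/
theorem card_mul_succ_le_card_connSets (hS : IsConn G S) :
    S.card * (S.card + 1) ≤ 2 * (connSets G S).card := by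
  induction hm : S.card generalizing S with
  | zero => omega
  | succ m ih =>
  obtain ⟨x, hx⟩ := hS.nonempty
  by_cases hne : {x} = S
  · subst hne
    simp only [Finset.card_singleton] at hm
    have : m = 0 := by omega
    simp [this, connSets_singleton]
  obtain ⟨v, hv, -, hSv⟩ := hS.exists_isConn_erase (isConn_singleton x)
    (Finset.singleton_subset_iff.2 hx) hne
  have h1 := ih hSv (by rw [Finset.card_erase_of_mem hv]; omega)
  have h2 := card_le_card_connSetsAt hS hv
  have h3 := card_connSets_eq_erase_add (G := G) (S := S) v
  nlinarith

/-! ### Connected sets with a prescribed linear arrangement -/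

/-- `f` numbers the vertices of `S` by `0, …, |S| - 1` in such a way that adjacency in `S` is the
relation `R` on these numbers. -/
structure IsNumbering (G : SimpleGraph V) (R : ℕ → ℕ → Prop) (S : Finset V) (f : V → ℕ) :
    Prop where
  lt : ∀ x ∈ S, f x < S.card
  injOn : Set.InjOn f S
  adj_iff : ∀ x ∈ S, ∀ y ∈ S, G.Adj x y ↔ R (f x) (f y)

/-- Adjacency in the path `0, 1, 2, …`. -/
def PathRel (i j : ℕ) : Prop := i + 1 = j ∨ j + 1 = i

/-- Adjacency in the path `0, 1, 2, …` with the additional edge `{0, 2}`: a triangle with a pendant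
path. -/
def TadpoleRel (i j : ℕ) : Prop := PathRel i j ∨ i = 0 ∧ j = 2 ∨ i = 2 ∧ j = 0

variable {R : ℕ → ℕ → Prop} {f : V → ℕ}

omit [DecidableEq V] in
theorem IsNumbering.exists_eq (h : IsNumbering G R S f) {i : ℕ} (hi : i < S.card) :
    ∃ x ∈ S, f x = i := by
  have := Finset.surj_on_of_inj_on_of_card_le (s := S) (t := Finset.range S.card) (fun x _ => f x)
    (fun x hx => Finset.mem_range.2 (h.lt x hx)) (fun x y hx hy hxy => h.injOn hx hy hxy)
    (by simp) i (Finset.mem_range.2 hi)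
  obtain ⟨x, hx, h⟩ := this
  exact ⟨x, hx, h.symm⟩

theorem IsNumbering.erase (h : IsNumbering G R S f) (hr : r ∈ S) (hfr : f r + 1 = S.card) :
    IsNumbering G R (S.erase r) f where
  lt x hx := by
    rw [Finset.mem_erase] at hx
    have h1 := h.lt x hx.2
    have h2 : f x ≠ f r := fun h' => hx.1 (h.injOn hx.2 hr h')
    rw [Finset.card_erase_of_mem hr]
    omega
  injOn := h.injOn.mono (Finset.coe_subset.2 (Finset.erase_subset _ _))
  adj_iff x hx y hy := h.adj_iff x (Finset.mem_of_mem_erase hx) y (Finset.mem_of_mem_erase hy)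

/-- A numbering extends to a new vertex `v` attached to the last vertex, if `R` joins the new
number to its predecessor only. -/
theorem IsNumbering.update (h : IsNumbering G R (S.erase r) f) (hr : r ∈ S) {s : V}
    (hs : s ∈ S.erase r) (hfs : f s + 2 = S.card) (hrs : G.Adj r s)
    (hleaf : ∀ x ∈ S, G.Adj r x → x = s) (hR : ∀ i < S.card, R (S.card - 1) i ↔ i + 2 = S.card)
    (hR' : ∀ i < S.card, R i (S.card - 1) ↔ i + 2 = S.card) :
    IsNumbering G R S (Function.update f r (S.card - 1)) := by
  have hc : (S.erase r).card + 1 = S.card := Finset.card_erase_add_one hr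
  have hlt : ∀ x ∈ S, x ≠ r → f x + 1 < S.card := fun x hx hxr => by
    have := h.lt x (Finset.mem_erase.2 ⟨hxr, hx⟩)
    omega
  have hiff : ∀ x ∈ S, x ≠ r → (G.Adj r x ↔ f x + 2 = S.card) := fun x hx hxr => by
    constructor
    · intro hrx
      rw [hleaf x hx hrx, hfs]
    · intro hfx
      rwa [h.injOn (Finset.mem_coe.2 (Finset.mem_erase.2 ⟨hxr, hx⟩)) hs (by omega)]
  refine ⟨fun x hx => ?_, fun x hx y hy hxy => ?_, fun x hx y hy => ?_⟩
  · by_cases hxr : x = r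
    · subst hxr
      simp only [Function.update_self]
      omega
    · simp only [Function.update_of_ne hxr]
      have := hlt x hx hxr
      omega
  · by_cases hxr : x = r <;> by_cases hyr : y = r
    · rw [hxr, hyr]
    · subst hxr
      simp only [Function.update_self, Function.update_of_ne hyr] at hxy
      have := hlt y hy hyr
      omega
    · subst hyr
      simp only [Function.update_self, Function.update_of_ne hxr] at hxy
      have := hlt x hx hxr
      omega
    · simp only [Function.update_of_ne hxr, Function.update_of_ne hyr] at hxy
      exact h.injOn (Finset.mem_coe.2 (Finset.mem_erase.2 ⟨hxr, hx⟩))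
        (Finset.mem_coe.2 (Finset.mem_erase.2 ⟨hyr, hy⟩)) hxy
  · by_cases hxr : x = r <;> by_cases hyr : y = r
    · subst hxr hyr
      simp only [Function.update_self, SimpleGraph.irrefl, false_iff]
      rw [hR _ (by omega)]
      omega
    · subst hxr
      simp only [Function.update_self, Function.update_of_ne hyr]
      rw [hiff y hy hyr, hR _ (by have := hlt y hy hyr; omega)]
    · subst hyr
      simp only [Function.update_self, Function.update_of_ne hxr]
      rw [G.adj_comm, hiff x hx hxr, hR' _ (by have := hlt x hx hxr; omega)]
    · simp only [Function.update_of_ne hxr, Function.update_of_ne hyr]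
      exact h.adj_iff x (Finset.mem_erase.2 ⟨hxr, hx⟩) y (Finset.mem_erase.2 ⟨hyr, hy⟩)

omit [DecidableEq V] in
theorem IsNumbering.reverse (h : IsNumbering G PathRel S f) :
    IsNumbering G PathRel S (fun x => S.card - 1 - f x) where
  lt x hx := by
    have := h.lt x hx
    omega
  injOn x hx y hy hxy := by
    have h1 := h.lt x hx
    have h2 := h.lt y hy
    exact h.injOn hx hy (by simp only at hxy; omega)
  adj_iff x hx y hy := by
    have h1 := h.lt x hx
    have h2 := h.lt y hy
    rw [h.adj_iff x hx y hy, PathRel, PathRel]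
    omega

/-- A connected set with as few connected subsets as a path is a path. -/
theorem exists_isNumbering_pathRel (hS : IsConn G S)
    (h : 2 * (connSets G S).card ≤ S.card * (S.card + 1)) :
    ∃ f, IsNumbering G PathRel S f := by
  induction hm : S.card generalizing S with
  | zero => exact absurd (Finset.card_pos.2 hS.nonempty) (by omega)
  | succ m ih =>
  obtain ⟨y, hy⟩ := hS.nonempty
  by_cases hne : {y} = S
  · subst hne
    refine ⟨fun _ => 0, by simp, by simp, ?_⟩
    simp [PathRel]
  obtain ⟨v, hv, hvy, hSv⟩ := hS.exists_isConn_erase (isConn_singleton y)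
    (Finset.singleton_subset_iff.2 hy) hne
  rw [Finset.mem_singleton] at hvy
  have hc : (S.erase v).card + 1 = S.card := Finset.card_erase_add_one hv
  have hcm : (S.erase v).card = m := by omega
  have hpos := Finset.card_pos.2 hSv.nonempty
  have h1 := card_mul_succ_le_card_connSets hSv
  have h2 := card_le_card_connSetsAt hS hv
  have h3 := card_connSets_eq_erase_add (G := G) (S := S) v
  rw [hm] at h h2
  rw [hcm] at h1 hpos
  have hv_eq : (connSetsAt G v S).card = m + 1 := by nlinarith
  obtain ⟨f, hf⟩ := ih hSv (by rw [hcm]; nlinarith) hcm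
  obtain ⟨x, hx, hvx⟩ := hS.exists_adj_mem hv (by omega)
  have hxS := Finset.mem_of_mem_erase hx
  -- A vertex contained in so few connected sets is a leaf.
  have hleaf : ∀ z ∈ S, G.Adj v z → z = x := by
    intro z hz hvz
    by_contra hzx
    have h4 := two_mul_card_le_card_connSetsAt hS hv hz hxS hzx hvz hvx
    have h5 : ({v, z, x} : Finset V).card ≤ S.card := Finset.card_le_card (by
      simp only [Finset.insert_subset_iff, Finset.singleton_subset_iff]
      exact ⟨hv, hz, hxS⟩)
    rw [Finset.card_eq_three.2 ⟨v, z, x, hvz.ne, hvx.ne, hzx, rfl⟩] at h5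
    omega
  have hx_eq := card_connSetsAt_leaf hv hxS hvx hleaf
  -- The neighbour `x` of `v` is an end of the path `S \ {v}` for the same reason.
  have hend : f x = 0 ∨ f x + 1 = m := by
    by_contra! hcon
    have hfx := hf.lt x hx
    obtain ⟨a, ha, hfa⟩ := hf.exists_eq (i := f x - 1) (by omega)
    obtain ⟨b, hb, hfb⟩ := hf.exists_eq (i := f x + 1) (by omega)
    have h4 := two_mul_card_le_card_connSetsAt hSv hx ha hb
      (fun h => by rw [h] at hfa; omega)
      ((hf.adj_iff x hx a ha).2 (Or.inr (by omega)))
      ((hf.adj_iff x hx b hb).2 (Or.inl (by omega)))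
    omega
  have hext : ∀ g, IsNumbering G PathRel (S.erase v) g → g x + 1 = m →
      ∃ f, IsNumbering G PathRel S f := fun g hg hgx =>
    ⟨_, hg.update hv hx (by omega) hvx hleaf
      (fun i hi => by rw [PathRel]; omega) (fun i hi => by rw [PathRel]; omega)⟩
  rcases hend with h0 | h0
  · exact hext _ hf.reverse (by simp only [h0]; omega)
  · exact hext f hf h0

end ConnInduced

/-! ### Connected splittings and the weighted lower bound -/

namespace ConnInduced

/-- Convexity of `2 ^ x`: for a given sum of the exponents the balanced sum is the least, and it is
the only one with this value. -/
theorem two_pow_balanced {s t q : ℕ} (h : s + t = q) :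
    2 ^ (q / 2) + 2 ^ ((q + 1) / 2) ≤ 2 ^ s + 2 ^ t ∧
      (2 ^ s + 2 ^ t = 2 ^ (q / 2) + 2 ^ ((q + 1) / 2) → s = q / 2 ∨ t = q / 2) := by
  wlog hst : s ≤ t generalizing s t
  · have := this (s := t) (t := s) (by omega) (by omega)
    rw [add_comm (2 ^ s), or_comm]
    exact this
  obtain ⟨d, hd⟩ : ∃ d, q / 2 = s + d := ⟨q / 2 - s, by omega⟩
  obtain ⟨e, he⟩ : ∃ e, (q + 1) / 2 = s + d + e := ⟨(q + 1) / 2 - (s + d), by omega⟩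
  have ht : t = s + d + e + d := by omega
  rw [hd, he, ht]
  have h1 : 0 < 2 ^ s := by positivity
  have h2 : 1 ≤ 2 ^ d := Nat.one_le_two_pow
  have h3 : 1 ≤ 2 ^ e := Nat.one_le_two_pow
  have key : 2 ^ s + 2 ^ (s + d + e + d) =
      2 ^ (s + d) + 2 ^ (s + d + e) + 2 ^ s * ((2 ^ d * 2 ^ e - 1) * (2 ^ d - 1)) := by
    obtain ⟨D, hD⟩ : ∃ D, 2 ^ d = D + 1 := ⟨2 ^ d - 1, by omega⟩
    obtain ⟨E, hE⟩ : ∃ E, 2 ^ e = E + 1 := ⟨2 ^ e - 1, by omega⟩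
    have : (D + 1) * (E + 1) - 1 = D * E + D + E := by
      rw [show (D + 1) * (E + 1) = D * E + D + E + 1 by ring, Nat.add_sub_cancel]
    simp only [pow_add, hD, hE, this, Nat.add_sub_cancel]
    ring
  refine ⟨by omega, fun heq => Or.inl ?_⟩
  have h4 : 2 ^ s * ((2 ^ d * 2 ^ e - 1) * (2 ^ d - 1)) = 0 := by omega
  by_contra hne
  have hd0 : 2 ≤ 2 ^ d := by
    calc 2 = 2 ^ 1 := rfl
      _ ≤ 2 ^ d := Nat.pow_le_pow_right (by norm_num) (by omega)
  have : 2 ≤ 2 ^ d * 2 ^ e := by nlinarith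
  simp only [mul_eq_zero] at h4
  omega

variable {V : Type*} {G : SimpleGraph V} [DecidableEq V] {S : Finset V} {r : V}

open Classical in
/-- The parts of the partitions of `S` into two connected sets. -/
noncomputable def splits (G : SimpleGraph V) (S : Finset V) : Finset (Finset V) :=
  {A ∈ connSets G S | IsConn G (S \ A)}

theorem mem_splits {A : Finset V} :
    A ∈ splits G S ↔ A ⊆ S ∧ IsConn G A ∧ IsConn G (S \ A) := by
  simp [splits, and_assoc]

/-- A connected set on `m` vertices has at least `m - 1` partitions into two connected sets, one for
each edge of a spanning tree. Spanning trees are avoided by induction: a non-cut vertex `v` splits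
off, and it can be added to the part containing a given neighbour of `v` in each partition of the
rest. -/
theorem two_mul_card_le_card_splits (hS : IsConn G S) : 2 * S.card ≤ (splits G S).card + 2 := by
  induction hm : S.card generalizing S with
  | zero => omega
  | succ m ih =>
  obtain ⟨y, hy⟩ := hS.nonempty
  by_cases hne : {y} = S
  · subst hne
    rw [Finset.card_singleton] at hm
    omega
  obtain ⟨v, hv, hvy, hSv⟩ := hS.exists_isConn_erase (isConn_singleton y)
    (Finset.singleton_subset_iff.2 hy) hne
  have hc : (S.erase v).card + 1 = S.card := Finset.card_erase_add_one hv
  have hpos := Finset.card_pos.2 hSv.nonempty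
  obtain ⟨x, hx, hvx⟩ := hS.exists_adj_mem hv (by omega)
  have hih := ih hSv (by omega)
  let g : Finset V → Finset V := fun A => if x ∈ A then insert v A else A
  have hvA : ∀ A ∈ splits G (S.erase v), v ∉ A := fun A hA =>
    (Finset.subset_erase.1 (mem_splits.1 hA).1).2
  have hvS : ∀ B ⊆ S, v ∈ B → S \ B = S.erase v \ B.erase v := fun B hB hvB => by
    ext z
    simp only [Finset.mem_sdiff, Finset.mem_erase]
    by_cases hzv : z = v <;> simp [hzv, hvB]
  have hsub : insert {v} (insert (S.erase v) ((splits G (S.erase v)).image g)) ⊆ splits G S := by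
    intro B hB
    simp only [Finset.mem_insert, Finset.mem_image] at hB
    rw [mem_splits]
    rcases hB with rfl | rfl | ⟨A, hA, rfl⟩
    · refine ⟨Finset.singleton_subset_iff.2 hv, isConn_singleton v, ?_⟩
      rwa [Finset.sdiff_singleton_eq_erase]
    · refine ⟨Finset.erase_subset _ _, hSv, ?_⟩
      rw [Finset.sdiff_erase_self hv]
      exact isConn_singleton v
    · have hvA' := hvA A hA
      obtain ⟨hAS, hA1, hA2⟩ := mem_splits.1 hA
      obtain ⟨hAS', -⟩ := Finset.subset_erase.1 hAS
      by_cases hxA : x ∈ A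
      · simp only [g, if_pos hxA]
        refine ⟨Finset.insert_subset hv hAS', hA1.insert hxA hvx.symm, ?_⟩
        rwa [hvS _ (Finset.insert_subset hv hAS') (Finset.mem_insert_self _ _),
          Finset.erase_insert hvA']
      · simp only [g, if_neg hxA]
        refine ⟨hAS', hA1, ?_⟩
        have : S \ A = insert v (S.erase v \ A) := by
          ext z
          simp only [Finset.mem_sdiff, Finset.mem_insert, Finset.mem_erase]
          by_cases hzv : z = v <;> simp [hzv, hv, hvA']
        rw [this]
        exact hA2.insert (Finset.mem_sdiff.2 ⟨hx, hxA⟩) hvx.symm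
  have hinj : Set.InjOn g (splits G (S.erase v)) := by
    intro A hA B hB hAB
    have h : ∀ C ∈ splits G (S.erase v), (g C).erase v = C := fun C hC => by
      by_cases hxC : x ∈ C
      · simp only [g, if_pos hxC, Finset.erase_insert (hvA C hC)]
      · simp only [g, if_neg hxC, Finset.erase_eq_of_notMem (hvA C hC)]
    rw [← h A hA, ← h B hB, hAB]
  have hcard := Finset.card_le_card hsub
  rw [Finset.card_insert_of_notMem, Finset.card_insert_of_notMem,
    Finset.card_image_of_injOn hinj] at hcard
  · omega
  · intro h
    obtain ⟨A, hA, h⟩ := Finset.mem_image.1 h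
    by_cases hxA : x ∈ A
    · simp only [g, if_pos hxA] at h
      exact Finset.notMem_erase v S (h ▸ Finset.mem_insert_self _ _)
    · simp only [g, if_neg hxA] at h
      exact hxA (h ▸ hx)
  · rw [Finset.mem_insert, not_or]
    constructor
    · intro h
      exact Finset.notMem_erase v S (h ▸ Finset.mem_singleton_self v)
    · intro h
      obtain ⟨A, hA, h⟩ := Finset.mem_image.1 h
      by_cases hxA : x ∈ A
      · simp only [g, if_pos hxA] at h
        have : x ∈ ({v} : Finset V) := h ▸ Finset.mem_insert_of_mem hxA
        exact hvx.ne (Finset.mem_singleton.1 this).symm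
      · simp only [g, if_neg hxA] at h
        exact hvA A hA (h ▸ Finset.mem_singleton_self v)

/-- The contributions to `wSum` of `S` itself, of the connected splittings, and of the remaining
connected sets. The two parts of a splitting have total weight `q`, so by convexity they contribute
at least as much as in the balanced case. The splittings are collected in `P`, and the remaining
connected sets in `R`. -/
theorem exists_wSum_eq (w : V → ℕ) (hS : IsConn G S) {q : ℕ} (hq : ∑ x ∈ S, w x = q) :
    ∃ P R : Finset (Finset V), (connSets G S).card = 1 + P.card + R.card ∧
      2 * S.card ≤ P.card + 2 ∧
      P.card * (2 ^ (q / 2) + 2 ^ ((q + 1) / 2)) ≤ 2 * ∑ A ∈ P, 2 ^ ∑ x ∈ A, w x ∧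
      wSum G w S = 2 ^ q + ∑ A ∈ P, 2 ^ (∑ x ∈ A, w x) + ∑ A ∈ R, 2 ^ ∑ x ∈ A, w x ∧
      ∀ A ⊆ S, IsConn G A → A ≠ S → ¬ IsConn G (S \ A) → A ∈ R := by
  have hdisj : S ∉ splits G S := fun h => by
    simpa using (mem_splits.1 h).2.2.nonempty
  have hsub : insert S (splits G S) ⊆ connSets G S := by
    refine Finset.insert_subset (mem_connSets.2 ⟨subset_rfl, hS⟩) fun A hA => ?_
    exact mem_connSets.2 ⟨(mem_splits.1 hA).1, (mem_splits.1 hA).2.1⟩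
  refine ⟨splits G S, connSets G S \ insert S (splits G S), ?_, two_mul_card_le_card_splits hS,
    ?_, ?_, ?_⟩
  · rw [← Finset.card_sdiff_add_card_eq_card hsub, Finset.card_insert_of_notMem hdisj]
    omega
  · have hinv : ∑ A ∈ splits G S, 2 ^ ∑ x ∈ A, w x =
        ∑ A ∈ splits G S, 2 ^ ∑ x ∈ S \ A, w x := by
      refine Finset.sum_nbij' (S \ ·) (S \ ·) ?_ ?_ ?_ ?_ ?_
      · intro A hA
        obtain ⟨h1, h2, h3⟩ := mem_splits.1 hA
        exact mem_splits.2 ⟨Finset.sdiff_subset, h3, by rwa [Finset.sdiff_sdiff_eq_self h1]⟩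
      · intro A hA
        obtain ⟨h1, h2, h3⟩ := mem_splits.1 hA
        exact mem_splits.2 ⟨Finset.sdiff_subset, h3, by rwa [Finset.sdiff_sdiff_eq_self h1]⟩
      · exact fun A hA => Finset.sdiff_sdiff_eq_self (mem_splits.1 hA).1
      · exact fun A hA => Finset.sdiff_sdiff_eq_self (mem_splits.1 hA).1
      · intro A hA
        rw [Finset.sdiff_sdiff_eq_self (mem_splits.1 hA).1]
    rw [two_mul]
    nth_rewrite 2 [hinv]
    rw [← Finset.sum_add_distrib, ← smul_eq_mul]
    refine Finset.card_nsmul_le_sum _ _ _ fun A hA => (two_pow_balanced ?_).1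
    rw [← hq, add_comm, Finset.sum_sdiff (mem_splits.1 hA).1]
  · rw [wSum, ← Finset.sum_sdiff hsub, Finset.sum_insert hdisj, hq]
    ring
  · intro A hAS hA hne hnot
    simp only [Finset.mem_sdiff, mem_connSets, Finset.mem_insert, mem_splits]
    tauto

/-- The lower bound for `wSum` over a connected set with `k + 1` vertices and total weight `q`. -/
theorem le_two_mul_wSum (w : V → ℕ) (hS : IsConn G S) {q k : ℕ} (hq : ∑ x ∈ S, w x = q)
    (hk : S.card = k + 1) :
    2 * 2 ^ q + 2 * k * (2 ^ (q / 2) + 2 ^ ((q + 1) / 2)) + k * k ≤ 2 * wSum G w S + k := by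
  obtain ⟨P, R, h1, h2, h3, h4, -⟩ := exists_wSum_eq w hS hq
  have h5 := card_mul_succ_le_card_connSets hS
  have h6 : R.card ≤ ∑ A ∈ R, 2 ^ ∑ x ∈ A, w x := by
    simpa using Finset.card_nsmul_le_sum R (fun A => 2 ^ ∑ x ∈ A, w x) 1
      fun A _ => Nat.one_le_two_pow
  have h10 : 2 ≤ 2 ^ (q / 2) + 2 ^ ((q + 1) / 2) :=
    Nat.add_le_add Nat.one_le_two_pow Nat.one_le_two_pow
  rw [hk] at h2 h5
  -- More than `2 k` parts of splittings only increase the bound, as `2 ≤ c`.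
  generalize 2 ^ (q / 2) + 2 ^ ((q + 1) / 2) = c at *
  obtain ⟨c, rfl⟩ : ∃ d, c = d + 2 := ⟨c - 2, by omega⟩
  obtain ⟨e, he⟩ : ∃ e, P.card = 2 * k + e := ⟨P.card - 2 * k, by omega⟩
  rw [he] at h1 h3
  nlinarith [Nat.zero_le (e * c)]

/-- Inner vertices of a path are cut vertices. -/
theorem IsNumbering.not_isConn_erase {f : V → ℕ} (hf : IsNumbering G PathRel S f) {x : V}
    (hx : x ∈ S) (h0 : f x ≠ 0) (h1 : f x + 1 ≠ S.card) : ¬ IsConn G (S.erase x) := by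
  intro h
  have hlt := hf.lt x hx
  obtain ⟨a, ha, hfa⟩ := hf.exists_eq (i := 0) (by omega)
  obtain ⟨b, hb, hfb⟩ := hf.exists_eq (i := f x + 1) (by omega)
  obtain ⟨u, hu, v, hv, hvB, huv⟩ := h.exists_adj (B := {z ∈ S.erase x | f z < f x})
    (Finset.filter_subset _ _)
    ⟨a, by
      simp only [Finset.mem_filter, Finset.mem_erase]
      exact ⟨⟨by rintro rfl; exact h0 hfa, ha⟩, by omega⟩⟩
    (fun h => by
      have : b ∈ S.erase x := Finset.mem_erase.2 ⟨by rintro rfl; omega, hb⟩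
      rw [← h, Finset.mem_filter] at this
      omega)
  simp only [Finset.mem_filter, Finset.mem_erase, not_and, not_lt] at hu hv hvB
  have h2 := hvB hv
  have h3 : f v ≠ f x := fun h' => hv.1 (hf.injOn hv.2 hx h')
  rw [hf.adj_iff u hu.1.2 v hv.2, PathRel] at huv
  omega

/-- In the case of equality the connected set is a path whose inner vertices have weight zero. -/
theorem exists_isNumbering_of_wSum_le (w : V → ℕ) (hS : IsConn G S) {q k : ℕ}
    (hq : ∑ x ∈ S, w x = q) (hk : S.card = k + 1)
    (h : 2 * wSum G w S + k ≤
      2 * 2 ^ q + 2 * k * (2 ^ (q / 2) + 2 ^ ((q + 1) / 2)) + k * k) :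
    ∃ f, IsNumbering G PathRel S f ∧ ∀ x ∈ S, f x ≠ 0 → f x ≠ k → w x = 0 := by
  obtain ⟨P, R, h1, h2, h3, h4, hR⟩ := exists_wSum_eq w hS hq
  have h5 := card_mul_succ_le_card_connSets hS
  have h6 : R.card ≤ ∑ A ∈ R, 2 ^ ∑ x ∈ A, w x := by
    simpa using Finset.card_nsmul_le_sum R (fun A => 2 ^ ∑ x ∈ A, w x) 1
      fun A _ => Nat.one_le_two_pow
  have h10 : 2 ≤ 2 ^ (q / 2) + 2 ^ ((q + 1) / 2) :=
    Nat.add_le_add Nat.one_le_two_pow Nat.one_le_two_pow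
  have h9 : ∑ A ∈ R, 2 ^ (∑ x ∈ A, w x) ≤ R.card ∧
      2 * (connSets G S).card ≤ (k + 1) * (k + 1 + 1) := by
    rw [hk] at h2 h5
    -- As in `le_two_mul_wSum`, with `2 k + e` parts of splittings.
    generalize 2 ^ (q / 2) + 2 ^ ((q + 1) / 2) = c at *
    obtain ⟨c, rfl⟩ : ∃ d, c = d + 2 := ⟨c - 2, by omega⟩
    obtain ⟨e, he⟩ : ∃ e, P.card = 2 * k + e := ⟨P.card - 2 * k, by omega⟩
    rw [he] at h1 h3
    constructor <;> nlinarith [Nat.zero_le (e * c)]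
  obtain ⟨f, hf⟩ := exists_isNumbering_pathRel hS (by rw [hk]; exact h9.2)
  refine ⟨f, hf, fun x hx hx0 hxk => ?_⟩
  have hxR : {x} ∈ R := by
    refine hR _ (Finset.singleton_subset_iff.2 hx) (isConn_singleton x) ?_ ?_
    · rintro rfl
      have := hf.lt x hx
      rw [Finset.card_singleton] at this
      omega
    · rw [Finset.sdiff_singleton_eq_erase]
      exact hf.not_isConn_erase hx hx0 (by omega)
  by_contra hwx
  refine absurd h9.1 (not_le.2 ?_)
  calc R.card = ∑ A ∈ R, 1 := by simp
    _ < _ := Finset.sum_lt_sum (fun A _ => Nat.one_le_two_pow)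
      ⟨{x}, hxR, by simpa using Nat.one_lt_two_pow hwx⟩

/-! ### Exact counts for paths and tadpoles -/

/-- The last vertex of a numbering is a leaf attached to its predecessor, if `R` says so. -/
theorem IsNumbering.exists_leaf {R : ℕ → ℕ → Prop} {f : V → ℕ} (h : IsNumbering G R S f)
    (hr : r ∈ S) (hfr : f r + 1 = S.card) (h2 : 2 ≤ S.card)
    (hR : ∀ i < S.card, R (S.card - 1) i ↔ i + 2 = S.card) :
    ∃ s ∈ S.erase r, f s + 1 = (S.erase r).card ∧ G.Adj r s ∧ ∀ x ∈ S, G.Adj r x → x = s := by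
  have hiff : ∀ x ∈ S, G.Adj r x ↔ f x + 2 = S.card := fun x hx => by
    rw [h.adj_iff r hr x hx, ← hR _ (h.lt x hx), ← hfr, Nat.add_sub_cancel]
  obtain ⟨s, hs, hfs⟩ := h.exists_eq (i := S.card - 2) (by omega)
  refine ⟨s, Finset.mem_erase.2 ⟨?_, hs⟩, ?_, (hiff s hs).2 (by omega), fun x hx hrx => ?_⟩
  · rintro rfl
    omega
  · rw [Finset.card_erase_of_mem hr]
    omega
  · have := (hiff x hx).1 hrx
    exact h.injOn hx hs (by omega)

/-- Counts for a path whose only weight is at its first vertex `y`, by deleting the last vertex `z`. -/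
theorem IsNumbering.wSum_of_weight_at_start {f : V → ℕ} (w : V → ℕ)
    (hf : IsNumbering G PathRel S f) {y z : V} (hy : y ∈ S) (hz : z ∈ S) (hfy : f y = 0)
    (hfz : f z + 1 = S.card) (hw : ∀ x ∈ S, f x ≠ 0 → w x = 0) :
    wSumAt G w z S + 1 = 2 ^ w y + S.card ∧
      2 * wSum G w S + S.card = 2 * S.card * 2 ^ w y + S.card * S.card := by
  induction hm : S.card generalizing S z with
  | zero => omega
  | succ m ih =>
  rcases Nat.eq_zero_or_pos m with rfl | hpos
  · obtain ⟨x, rfl⟩ := Finset.card_eq_one.1 hm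
    rw [Finset.mem_singleton] at hy hz
    subst hy hz
    simp only [wSum, wSumAt, connSets_singleton, connSetsAt_singleton, Finset.sum_singleton]
    constructor <;> simp
  have hc : (S.erase z).card + 1 = S.card := Finset.card_erase_add_one hz
  obtain ⟨s, hs, hfs, hzs, hleaf⟩ := hf.exists_leaf hz hfz (by omega)
    (fun i hi => by rw [PathRel]; omega)
  have hyz : y ≠ z := by
    rintro rfl
    omega
  obtain ⟨h1, h2⟩ := ih (hf.erase hz hfz) (Finset.mem_erase.2 ⟨hyz, hy⟩) hs hfs
    (fun x hx => hw x (Finset.mem_of_mem_erase hx)) (by omega)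
  have h3 := wSumAt_leaf w hz (Finset.mem_of_mem_erase hs) hzs hleaf
  rw [hw z hz (by omega), pow_zero, one_mul] at h3
  have h4 := wSum_eq_erase_add (G := G) (S := S) w z
  constructor
  · omega
  · nlinarith

/-- A path whose inner vertices have weight zero attains the lower bound, up to balancing the
weights of its ends. -/
theorem IsNumbering.two_mul_wSum {f : V → ℕ} (w : V → ℕ) (hf : IsNumbering G PathRel S f)
    {y z : V} {k : ℕ} (hk : S.card = k + 1) (hk1 : 1 ≤ k) (hy : y ∈ S) (hz : z ∈ S)
    (hfy : f y = 0) (hfz : f z = k) (hw : ∀ x ∈ S, f x ≠ 0 → f x ≠ k → w x = 0) :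
    2 * wSum G w S + k = 2 * 2 ^ (w y + w z) + 2 * k * (2 ^ w y + 2 ^ w z) + k * k := by
  have hc : (S.erase z).card + 1 = S.card := Finset.card_erase_add_one hz
  obtain ⟨s, hs, hfs, hzs, hleaf⟩ := hf.exists_leaf hz (by omega) (by omega)
    (fun i hi => by rw [PathRel]; omega)
  have hyz : y ≠ z := by
    rintro rfl
    omega
  obtain ⟨h1, h2⟩ := (hf.erase hz (by omega)).wSum_of_weight_at_start w
    (Finset.mem_erase.2 ⟨hyz, hy⟩) hs hfy hfs (fun x hx hx0 => by
      obtain ⟨hxz, hxS⟩ := Finset.mem_erase.1 hx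
      exact hw x hxS hx0 fun h => hxz (hf.injOn hxS hz (by omega)))
  have h3 := wSumAt_leaf w hz (Finset.mem_of_mem_erase hs) hzs hleaf
  have h4 := wSum_eq_erase_add (G := G) (S := S) w z
  have hck : (S.erase z).card = k := by omega
  rw [hck] at h1 h2
  have h5 : 1 + wSumAt G w s (S.erase z) = 2 ^ w y + k := by omega
  rw [h4, h3, h5, pow_add]
  nlinarith

theorem card_connSets_of_clique (h : ∀ x ∈ S, ∀ y ∈ S, x ≠ y → G.Adj x y) :
    (connSets G S).card + 1 = 2 ^ S.card := by
  have : connSets G S = S.powerset.erase ∅ := by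
    ext A
    rw [mem_connSets, Finset.mem_erase, Finset.mem_powerset, and_comm, ← Finset.nonempty_iff_ne_empty,
      and_congr_left_iff]
    refine fun hAS => ⟨fun hA => hA.nonempty, fun hA => isConn_iff.2 ⟨hA, ?_⟩⟩
    rintro B hB ⟨u, hu⟩ hne
    obtain ⟨v, hv, hvB⟩ := Finset.exists_of_ssubset (hB.ssubset_of_ne hne)
    exact ⟨u, hu, v, hv, hvB, h u (hAS (hB hu)) v (hAS hv) (by rintro rfl; exact hvB hu)⟩
  rw [this, Finset.card_erase_add_one (Finset.empty_mem_powerset S), Finset.card_powerset]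

theorem tadpoleRel_last {m : ℕ} (hm : 4 ≤ m) (i : ℕ) (hi : i < m) :
    (TadpoleRel (m - 1) i ↔ i + 2 = m) ∧ (TadpoleRel i (m - 1) ↔ i + 2 = m) := by
  simp only [TadpoleRel, PathRel]
  omega

/-- Counts for a tadpole with end `r`, by deleting `r`; the smallest tadpole is a triangle. -/
theorem IsNumbering.card_tadpole {f : V → ℕ} (hf : IsNumbering G TadpoleRel S f) (hr : r ∈ S)
    (h3 : 3 ≤ S.card) (hfr : f r + 1 = S.card) :
    (connSetsAt G r S).card = S.card + 1 ∧
      2 * (connSets G S).card + 4 = S.card * S.card + 3 * S.card := by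
  induction hm : S.card generalizing S r with
  | zero => omega
  | succ m ih =>
  by_cases hm3 : m = 2
  · subst hm3
    have hadj : ∀ x ∈ S, ∀ y ∈ S, x ≠ y → G.Adj x y := fun x hx y hy hxy => by
      have h1 := hf.lt x hx
      have h2 := hf.lt y hy
      have h3 : f x ≠ f y := fun h => hxy (hf.injOn hx hy h)
      rw [hf.adj_iff x hx y hy, TadpoleRel, PathRel]
      omega
    have h1 := card_connSets_of_clique hadj
    have h2 := card_connSets_of_clique (S := S.erase r) fun x hx y hy =>
      hadj x (Finset.mem_of_mem_erase hx) y (Finset.mem_of_mem_erase hy)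
    have h3 := card_connSets_eq_erase_add (G := G) (S := S) r
    rw [Finset.card_erase_of_mem hr, hm] at h2
    rw [hm] at h1
    omega
  · have hc : (S.erase r).card + 1 = S.card := Finset.card_erase_add_one hr
    obtain ⟨s, hs, hfs, hrs, hleaf⟩ := hf.exists_leaf hr hfr (by omega)
      (fun i hi => (tadpoleRel_last (by omega) i hi).1)
    obtain ⟨h1, h2⟩ := ih (hf.erase hr hfr) hs (by omega) hfs (by omega)
    have h3 := card_connSetsAt_leaf hr (Finset.mem_of_mem_erase hs) hrs hleaf
    have h4 := card_connSets_eq_erase_add (G := G) (S := S) r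
    constructor
    · omega
    · nlinarith

/-! ### The lower bound for one pendant vertex -/

theorem exists_isNumbering_triangle {a b : V} (hab : a ≠ b) (har : a ≠ r) (hbr : b ≠ r)
    (hS : {a, b, r} = S) (hadj : ∀ x ∈ S, ∀ y ∈ S, x ≠ y → G.Adj x y) :
    ∃ f, IsNumbering G TadpoleRel S f ∧ f r + 1 = S.card := by
  have hm : S.card = 3 := by
    rw [← hS]
    exact Finset.card_eq_three.2 ⟨a, b, r, hab, har, hbr, rfl⟩
  have hcases : ∀ x ∈ S, x = a ∨ x = b ∨ x = r := fun x hx => by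
    rw [← hS] at hx
    simpa using hx
  obtain ⟨f, hfa, hfb, hfr⟩ : ∃ f : V → ℕ, f a = 0 ∧ f b = 1 ∧ f r = 2 :=
    ⟨fun x => if x = a then 0 else if x = b then 1 else 2, by simp, by simp [hab.symm],
      by simp [har.symm, hbr.symm]⟩
  have hlt : ∀ x ∈ S, f x < 3 := fun x hx => by
    rcases hcases x hx with rfl | rfl | rfl <;> omega
  have hinj : ∀ x ∈ S, ∀ y ∈ S, f x = f y → x = y := by
    intro x hx y hy hxy
    rcases hcases x hx with rfl | rfl | rfl <;> rcases hcases y hy with rfl | rfl | rfl <;>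
      first | rfl | omega
  refine ⟨f, ⟨fun x hx => by rw [hm]; exact hlt x hx, fun x hx y hy => hinj x hx y hy, ?_⟩,
    by omega⟩
  intro x hx y hy
  by_cases hxy : x = y
  · subst hxy
    simp only [SimpleGraph.irrefl, TadpoleRel, PathRel, false_iff]
    omega
  · have h1 := hlt x hx
    have h2 := hlt y hy
    have h3 := mt (hinj x hx y hy) hxy
    simp only [hadj x hx y hy hxy, TadpoleRel, PathRel, true_iff]
    omega

/-- Let all vertices of the connected set `S` other than `r` have two neighbours in `S`. Then the
numbers of connected subsets of `S`, and of those containing `r`, are at least as large in total as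
for a tadpole with end `r`, with equality for tadpoles only.

If `r` is a leaf, it is stripped off. If not, and `|S| ≥ 4`, then every vertex lies in at least
`2 |S| - 2` connected sets, which is more than enough. -/
theorem card_connSets_add_card_connSetsAt (hS : IsConn G S) (hr : r ∈ S) (h3 : 3 ≤ S.card)
    (hdeg : ∀ x ∈ S, x ≠ r → ∃ a ∈ S, ∃ b ∈ S, a ≠ b ∧ G.Adj x a ∧ G.Adj x b) :
    S.card + 1 ≤ (connSetsAt G r S).card ∧
    S.card * S.card + 5 * S.card ≤
      2 * ((connSets G S).card + (connSetsAt G r S).card) + 2 ∧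
    (2 * ((connSets G S).card + (connSetsAt G r S).card) + 2 ≤ S.card * S.card + 5 * S.card →
      ∃ f, IsNumbering G TadpoleRel S f ∧ f r + 1 = S.card) := by
  induction hm : S.card generalizing S r with
  | zero => omega
  | succ m ih =>
  have hpair : ∀ x, (S.erase x).card ≤ 2 → ∀ a ∈ S, ∀ b ∈ S, a ≠ b → G.Adj x a → G.Adj x b →
      ∀ y ∈ S, x ≠ y → G.Adj x y := by
    intro x hx a ha b hb hab hxa hxb y hy hxy
    have : ({a, b} : Finset V) = S.erase x := by
      refine Finset.eq_of_subset_of_card_le ?_ (by rwa [Finset.card_pair hab])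
      simp only [Finset.insert_subset_iff, Finset.singleton_subset_iff, Finset.mem_erase]
      exact ⟨⟨hxa.ne.symm, ha⟩, hxb.ne.symm, hb⟩
    have hy' : y ∈ ({a, b} : Finset V) := this ▸ Finset.mem_erase.2 ⟨hxy.symm, hy⟩
    simp only [Finset.mem_insert, Finset.mem_singleton] at hy'
    rcases hy' with rfl | rfl <;> assumption
  by_cases hr2 : ∃ a ∈ S, ∃ b ∈ S, a ≠ b ∧ G.Adj r a ∧ G.Adj r b
  · obtain ⟨a, ha, b, hb, hab, hra, hrb⟩ := hr2
    have hNr := two_mul_card_le_card_connSetsAt hS hr ha hb hab hra hrb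
    by_cases hm3 : m = 2
    · -- `S` is a triangle.
      subst hm3
      have hadj : ∀ x ∈ S, ∀ y ∈ S, x ≠ y → G.Adj x y := by
        intro x hx
        have hx2 : (S.erase x).card ≤ 2 := by rw [Finset.card_erase_of_mem hx]; omega
        by_cases hxr : x = r
        · exact hxr ▸ hpair r (hxr ▸ hx2) a ha b hb hab hra hrb
        · obtain ⟨a, ha, b, hb, hab, hxa, hxb⟩ := hdeg x hx hxr
          exact hpair x hx2 a ha b hb hab hxa hxb
      have hSeq : ({a, b, r} : Finset V) = S := by
        refine Finset.eq_of_subset_of_card_le ?_ ?_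
        · simp only [Finset.insert_subset_iff, Finset.singleton_subset_iff]
          exact ⟨ha, hb, hr⟩
        · rw [hm, Finset.card_eq_three.2 ⟨a, b, r, hab, hra.ne.symm, hrb.ne.symm, rfl⟩]
      obtain ⟨f, hf, hfr⟩ := exists_isNumbering_triangle hab hra.ne.symm hrb.ne.symm hSeq hadj
      obtain ⟨h1, h2⟩ := hf.card_tadpole hr h3 hfr
      rw [hm] at h1 h2
      exact ⟨by omega, by omega, fun _ => ⟨f, hf, by omega⟩⟩
    · obtain ⟨v, hv, hvr, hSv⟩ := hS.exists_isConn_erase (isConn_singleton r)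
        (Finset.singleton_subset_iff.2 hr) (by
          rintro rfl
          rw [Finset.card_singleton] at h3
          omega)
      rw [Finset.mem_singleton] at hvr
      obtain ⟨c, hc, d, hd, hcd, hvc, hvd⟩ := hdeg v hv hvr
      have hNv := two_mul_card_le_card_connSetsAt hS hv hc hd hcd hvc hvd
      have hN := card_connSets_eq_erase_add (G := G) (S := S) v
      have hN' := card_mul_succ_le_card_connSets hSv
      rw [Finset.card_erase_of_mem hv, hm, Nat.add_sub_cancel] at hN'
      rw [hm] at hNr hNv
      have hm3' : 3 ≤ m := by omega
      have hlt : (m + 1) * (m + 1) + 5 * (m + 1) <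
          2 * ((connSets G S).card + (connSetsAt G r S).card) + 2 := by
        nlinarith
      exact ⟨by omega, hlt.le, fun h => absurd h (not_le.2 hlt)⟩
  · obtain ⟨s, hs, hrs⟩ := hS.exists_adj_mem hr (by omega)
    obtain ⟨hsr, hsS⟩ := Finset.mem_erase.1 hs
    have hleaf : ∀ x ∈ S, G.Adj r x → x = s := fun x hx hrx => by
      by_contra hxs
      exact hr2 ⟨x, hx, s, hsS, hxs, hrx, hrs⟩
    have hc : (S.erase r).card + 1 = S.card := Finset.card_erase_add_one hr
    have hdeg' : ∀ x ∈ S.erase r, x ≠ s →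
        ∃ a ∈ S.erase r, ∃ b ∈ S.erase r, a ≠ b ∧ G.Adj x a ∧ G.Adj x b := by
      intro x hx hxs
      obtain ⟨hxr, hxS⟩ := Finset.mem_erase.1 hx
      obtain ⟨a, ha, b, hb, hab, hxa, hxb⟩ := hdeg x hxS hxr
      refine ⟨a, Finset.mem_erase.2 ⟨?_, ha⟩, b, Finset.mem_erase.2 ⟨?_, hb⟩, hab, hxa, hxb⟩
      · rintro rfl
        exact hxs (hleaf x hxS hxa.symm)
      · rintro rfl
        exact hxs (hleaf x hxS hxb.symm)
    have h3' : 3 ≤ (S.erase r).card := by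
      obtain ⟨x, hx, hxs⟩ := Finset.exists_mem_ne (s := S.erase r) (by omega) s
      obtain ⟨a, ha, b, hb, hab, hxa, hxb⟩ := hdeg' x hx hxs
      rw [← Finset.card_eq_three.2 ⟨x, a, b, hxa.ne, hxb.ne, hab, rfl⟩]
      refine Finset.card_le_card ?_
      simp only [Finset.insert_subset_iff, Finset.singleton_subset_iff]
      exact ⟨hx, ha, hb⟩
    obtain ⟨h1, h2, h4⟩ := ih (hS.erase_leaf hleaf ⟨s, hs⟩) hs h3' hdeg' (by omega)
    have h5 := card_connSetsAt_leaf hr hsS hrs hleaf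
    have h6 := card_connSets_eq_erase_add (G := G) (S := S) r
    refine ⟨by omega, by nlinarith, fun h => ?_⟩
    obtain ⟨f, hf, hfs⟩ := h4 (by nlinarith)
    refine ⟨_, hf.update hr hs (by omega) hrs hleaf
      (fun i hi => (tadpoleRel_last (by omega) i hi).1)
      (fun i hi => (tadpoleRel_last (by omega) i hi).2), ?_⟩
    rw [Function.update_self]
    omega

end ConnInduced

/-! ### Deleting the pendant vertices -/

namespace ConnInduced

section Pendant

variable {V : Type*} {G : SimpleGraph V} [DecidableEq V] {L : Finset V} {π : V → V}

theorem IsConn.sdiff_pendant (hπ : ∀ l ∈ L, π l ∉ L ∧ ∀ x, G.Adj l x ↔ x = π l) {A : Finset V}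
    (hA : IsConn G A) (hne : (A \ L).Nonempty) : IsConn G (A \ L) := by
  have key : ∀ K ⊆ L, IsConn G (A \ K) := by
    intro K
    induction K using Finset.induction with
    | empty => simpa using hA
    | insert l K _ ih =>
      intro hK
      rw [Finset.insert_subset_iff] at hK
      rw [Finset.sdiff_insert]
      refine (ih hK.2).erase_leaf (fun x _ => ((hπ l hK.1).2 x).1) (hne.mono ?_)
      rw [← Finset.sdiff_insert]
      exact Finset.sdiff_subset_sdiff subset_rfl (Finset.insert_subset hK.1 hK.2)
  exact key L subset_rfl

theorem IsConn.union_pendant (hπ : ∀ l ∈ L, π l ∉ L ∧ ∀ x, G.Adj l x ↔ x = π l)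
    {B P : Finset V} (hB : IsConn G B) (hP : ∀ l ∈ P, l ∈ L ∧ π l ∈ B) : IsConn G (B ∪ P) := by
  induction P using Finset.induction with
  | empty => simpa using hB
  | insert l P _ ih =>
    obtain ⟨hl, hlB⟩ := hP l (Finset.mem_insert_self _ _)
    rw [Finset.union_insert]
    exact (ih fun x hx => hP x (Finset.mem_insert_of_mem hx)).insert
      (Finset.mem_union_left _ hlB) (((hπ l hl).2 _).2 rfl).symm

/-- Let every vertex `l` of `L` be a leaf whose neighbour `π l` lies outside `L`. Besides the
singletons in `L`, the connected sets are the unions of a connected set `B` outside `L` with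
arbitrarily many leaves attached to `B`. -/
theorem card_connSets_of_pendant [Fintype V]
    (hπ : ∀ l ∈ L, π l ∉ L ∧ ∀ x, G.Adj l x ↔ x = π l) :
    (connSets G Finset.univ).card =
      L.card + wSum G (fun x => {l ∈ L | π l = x}.card) Lᶜ := by
  have hmem : ∀ A, IsConn G A → ∀ l ∈ A, l ∈ L → A ≠ {l} → π l ∈ A := by
    intro A hA l hl hlL hne
    have h2 : 2 ≤ A.card := by
      by_contra hlt
      exact hne (Finset.eq_singleton_iff_unique_mem.2
        ⟨hl, fun x hx => Finset.card_le_one.1 (by omega) x hx l hl⟩)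
    obtain ⟨x, hx, hlx⟩ := hA.exists_adj_mem hl h2
    rw [(hπ l hlL).2] at hlx
    exact hlx ▸ Finset.mem_of_mem_erase hx
  rw [← Finset.card_filter_add_card_filter_not (s := connSets G Finset.univ) (fun A => A \ L = ∅)]
  congr 1
  · rw [← Finset.card_image_of_injective L Finset.singleton_injective]
    congr 1
    ext A
    simp only [Finset.mem_filter, mem_connSets, Finset.subset_univ, true_and,
      Finset.sdiff_eq_empty_iff_subset, Finset.mem_image]
    constructor
    · rintro ⟨hA, hAL⟩
      obtain ⟨l, hl⟩ := hA.nonempty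
      refine ⟨l, hAL hl, ?_⟩
      by_contra hne
      exact (hπ l (hAL hl)).1 (hAL (hmem A hA l hl (hAL hl) (Ne.symm hne)))
    · rintro ⟨l, hl, rfl⟩
      exact ⟨isConn_singleton l, Finset.singleton_subset_iff.2 hl⟩
  · rw [Finset.card_eq_sum_card_fiberwise (f := fun A => A \ L) (t := connSets G Lᶜ), wSum]
    · refine Finset.sum_congr rfl fun B hB => ?_
      obtain ⟨hBL, hB⟩ := mem_connSets.1 hB
      have hBL' : ∀ x ∈ B, x ∉ L := fun x hx => Finset.mem_compl.1 (hBL hx)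
      have hw : ∑ x ∈ B, {l ∈ L | π l = x}.card = {l ∈ L | π l ∈ B}.card := by
        rw [Finset.card_eq_sum_card_fiberwise (f := π) (s := {l ∈ L | π l ∈ B}) (t := B)
          (fun l hl => (Finset.mem_filter.1 (Finset.mem_coe.1 hl)).2)]
        refine Finset.sum_congr rfl fun x hx => congrArg _ ?_
        ext l
        simp only [Finset.mem_filter]
        exact ⟨fun h => ⟨⟨h.1, h.2 ▸ hx⟩, h.2⟩, fun h => ⟨h.1.1, h.2⟩⟩
      have hinj : Set.InjOn (B ∪ ·) (({l ∈ L | π l ∈ B}.powerset : Finset (Finset V)) :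
          Set (Finset V)) := by
        intro P hP Q hQ hPQ
        have h : ∀ P ∈ {l ∈ L | π l ∈ B}.powerset, (B ∪ P) \ B = P := fun P hP => by
          rw [Finset.union_sdiff_left, Finset.sdiff_eq_self_iff_disjoint, Finset.disjoint_left]
          intro x hx hxB
          exact hBL' x hxB (Finset.mem_filter.1 (Finset.mem_powerset.1 hP hx)).1
        rw [← h P hP, ← h Q hQ]
        exact congrArg (· \ B) hPQ
      rw [hw, ← Finset.card_powerset, ← Finset.card_image_of_injOn hinj]
      congr 1
      ext A
      simp only [Finset.mem_filter, mem_connSets, Finset.subset_univ, true_and, Finset.mem_image,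
        Finset.mem_powerset]
      constructor
      · rintro ⟨⟨hA, -⟩, rfl⟩
        refine ⟨A ∩ L, fun l hl => ?_, Finset.sdiff_union_inter A L⟩
        obtain ⟨hlA, hlL⟩ := Finset.mem_inter.1 hl
        refine Finset.mem_filter.2 ⟨hlL, Finset.mem_sdiff.2 ⟨?_, (hπ l hlL).1⟩⟩
        refine hmem A hA l hlA hlL ?_
        rintro rfl
        obtain ⟨x, hx⟩ := hB.nonempty
        rw [Finset.mem_sdiff, Finset.mem_singleton] at hx
        exact hx.2 (hx.1 ▸ hlL)
      · rintro ⟨P, hP, rfl⟩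
        have hP' : ∀ l ∈ P, l ∈ L ∧ π l ∈ B := fun l hl => Finset.mem_filter.1 (hP hl)
        have hsd : (B ∪ P) \ L = B := by
          ext x
          simp only [Finset.mem_sdiff, Finset.mem_union]
          constructor
          · rintro ⟨hx | hx, hxL⟩
            · exact hx
            · exact absurd (hP' x hx).1 hxL
          · exact fun hx => ⟨Or.inl hx, hBL' x hx⟩
        refine ⟨⟨hB.union_pendant hπ hP', ?_⟩, hsd⟩
        rw [hsd]
        exact hB.nonempty.ne_empty
    · intro A hA
      simp only [Finset.coe_filter, Set.mem_ofPred_eq, mem_connSets, Finset.subset_univ,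
        true_and] at hA
      refine mem_connSets.2 ⟨fun x hx => ?_,
        hA.1.sdiff_pendant hπ (Finset.nonempty_iff_ne_empty.2 hA.2)⟩
      exact Finset.mem_compl.2 (Finset.mem_sdiff.1 hx).2

/-- In a connected graph with more than two vertices, no two pendant vertices are adjacent. -/
theorem exists_pendant_neighbor [Fintype V] (hG : G.Connected) (h3 : 3 ≤ Fintype.card V)
    (hL : ∀ l, l ∈ L ↔ ∃! x, G.Adj l x) :
    ∃ π : V → V, ∀ l ∈ L, π l ∉ L ∧ ∀ x, G.Adj l x ↔ x = π l := by
  have h : ∀ l, ∃ y, l ∈ L → ∀ x, G.Adj l x ↔ x = y := fun l => by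
    by_cases hl : l ∈ L
    · obtain ⟨y, hy, hy'⟩ := (hL l).1 hl
      refine ⟨y, fun _ x => ⟨hy' x, ?_⟩⟩
      rintro rfl
      exact hy
    · exact ⟨l, fun h => absurd h hl⟩
  choose π hπ using h
  refine ⟨π, fun l hl => ⟨fun hπl => ?_, hπ l hl⟩⟩
  have h1 : G.Adj l (π l) := (hπ l hl _).2 rfl
  have h2 : π (π l) = l := ((hπ _ hπl l).1 h1.symm).symm
  obtain ⟨u, hu, v, -, hv, huv⟩ := (isConn_univ hG).exists_adj (B := {l, π l})
    (Finset.subset_univ _) (Finset.insert_nonempty _ _) (fun h => by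
      have := congrArg Finset.card h
      rw [Finset.card_pair h1.ne, Finset.card_univ] at this
      omega)
  simp only [Finset.mem_insert, Finset.mem_singleton, not_or] at hu hv
  rcases hu with rfl | rfl
  · exact hv.2 ((hπ _ hl v).1 huv)
  · exact hv.1 (h2 ▸ (hπ _ hπl v).1 huv)

end Pendant

/-! ### Isomorphisms with the extremal graphs -/

section Iso

variable {V W : Type*} {G : SimpleGraph V} {H : SimpleGraph W}

theorem numConnInduced_eq_card [Fintype V] :
    numConnInduced G = (connSets G Finset.univ).card := by
  have : {S : Set V | (G.induce S).Connected} =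
      (fun A : Finset V => (A : Set V)) '' (connSets G Finset.univ : Finset (Finset V)) := by
    ext S
    simp only [Set.mem_ofPred_eq, Set.mem_image, Finset.mem_coe, mem_connSets, Finset.subset_univ,
      true_and]
    constructor
    · intro h
      refine ⟨S.toFinite.toFinset, ?_, S.toFinite.coe_toFinset⟩
      rwa [IsConn, S.toFinite.coe_toFinset]
    · rintro ⟨A, hA, rfl⟩
      exact hA
  rw [numConnInduced, this, Set.ncard_image_of_injective _ Finset.coe_injective,
    Set.ncard_coe_finset]

theorem numConnInduced_congr (e : G ≃g H) : numConnInduced G = numConnInduced H := by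
  refine Set.ncard_congr (fun S _ => e '' S) ?_ ?_ ?_
  · intro S hS
    exact (e.induce (e.injective.injOn.bijOn_image)).connected_iff.1 hS
  · intro S T _ _ h
    exact Set.image_injective.2 e.injective h
  · intro T hT
    refine ⟨e.symm '' T, ?_, ?_⟩
    · exact (e.symm.induce (e.symm.injective.injOn.bijOn_image)).connected_iff.1 hT
    · simp [Set.image_image]

/-- Graphs of the same order whose vertices are numbered for the same relation are isomorphic. -/
theorem IsNumbering.nonempty_iso [Fintype V] [Fintype W] {R : ℕ → ℕ → Prop} {f : V → ℕ}
    {g : W → ℕ} (hf : IsNumbering G R Finset.univ f) (hg : IsNumbering H R Finset.univ g)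
    (hc : Fintype.card V = Fintype.card W) : Nonempty (G ≃g H) := by
  have h : ∀ x, ∃ y, g y = f x := fun x => by
    have := hf.lt x (Finset.mem_univ x)
    rw [Finset.card_univ, hc, ← Finset.card_univ] at this
    obtain ⟨y, -, hy⟩ := hg.exists_eq this
    exact ⟨y, hy⟩
  choose φ hφ using h
  have hinj : Function.Injective φ := fun x y hxy =>
    hf.injOn (Finset.mem_coe.2 (Finset.mem_univ x)) (Finset.mem_coe.2 (Finset.mem_univ y))
      (by rw [← hφ x, ← hφ y, hxy])
  refine ⟨⟨Equiv.ofBijective φ ((Fintype.bijective_iff_injective_and_card φ).2 ⟨hinj, hc⟩), ?_⟩⟩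
  intro x y
  rw [hf.adj_iff x (Finset.mem_univ x) y (Finset.mem_univ y), ← hφ, ← hφ,
    ← hg.adj_iff _ (Finset.mem_univ _) _ (Finset.mem_univ _)]
  rfl

/-- The star on `k + 1` vertices has `k` vertices besides its centre. -/
theorem card_subtype_ne_zero (k : ℕ) : Fintype.card {w : Fin (k + 1) // w ≠ 0} = k := by
  simp

theorem card_trianglePath (n : ℕ) (h : 3 ≤ n) :
    Fintype.card (Fin (n - 2) ⊕ {w : Fin 3 // w ≠ 0}) = n := by
  rw [Fintype.card_sum, card_subtype_ne_zero, Fintype.card_fin]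
  omega

/-- The numbering of the tadpole that starts with the two vertices of the triangle off the path. -/
theorem isNumbering_trianglePath (n : ℕ) (h : 3 ≤ n) :
    IsNumbering (trianglePath n h) TadpoleRel Finset.univ
      (Sum.elim (fun i => i.1 + 2) (fun w => w.1.1 - 1)) := by
  have hpos : ∀ w : {w : Fin 3 // w ≠ 0}, w.1.1 ≠ 0 := fun w h0 => w.2 (Fin.ext h0)
  refine ⟨?_, ?_, ?_⟩
  · rw [Finset.card_univ, card_trianglePath n h]
    rintro (i | w) -
    · have := i.2
      simp only [Sum.elim_inl]
      omega
    · have := w.1.2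
      simp only [Sum.elim_inr]
      omega
  · rintro (i | w) - (j | v) - hij <;> simp only [Sum.elim_inl, Sum.elim_inr] at hij
    · exact congrArg _ (Fin.ext (by omega))
    · have := v.1.2
      omega
    · have := w.1.2
      omega
    · have h1 := hpos w
      have h2 := hpos v
      exact congrArg _ (Subtype.ext (Fin.ext (by omega)))
  · rintro (i | w) - (j | v) - <;>
      simp only [identifyVertices, Sum.elim_inl, Sum.elim_inr, SimpleGraph.pathGraph_adj,
        SimpleGraph.top_adj, TadpoleRel, PathRel, ne_eq, Fin.ext_iff, Fin.val_zero]
    · omega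
    · have h1 := hpos v
      have h2 := v.1.2
      omega
    · have h1 := hpos w
      have h2 := w.1.2
      omega
    · have h1 := hpos v
      have h2 := hpos w
      have h3 := v.1.2
      have h4 := w.1.2
      omega

theorem two_mul_numConnInduced_trianglePath (n : ℕ) (h : 3 ≤ n) :
    2 * numConnInduced (trianglePath n h) + 4 = n * n + 3 * n := by
  have hf := isNumbering_trianglePath n h
  have hc : (Finset.univ : Finset (Fin (n - 2) ⊕ {w : Fin 3 // w ≠ 0})).card = n := by
    rw [Finset.card_univ, card_trianglePath n h]
  have h1 := (hf.card_tadpole (r := Sum.inl ⟨n - 3, by omega⟩) (Finset.mem_univ _)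
    (by rw [hc]; exact h) (by rw [hc, Sum.elim_inl]; simp only; omega)).2
  rwa [hc, ← numConnInduced_eq_card] at h1

/-- The vertex type of `treeT1 n p`: the vertices of the path and the leaves at its two ends. -/
abbrev TreeT1Vertex (n p : ℕ) : Type :=
  (Fin (n - p) ⊕ {w : Fin (p / 2 + 1) // w ≠ 0}) ⊕ {w : Fin ((p + 1) / 2 + 1) // w ≠ 0}

theorem card_treeT1 (n p : ℕ) (h : p + 2 ≤ n) : Fintype.card (TreeT1Vertex n p) = n := by
  rw [Fintype.card_sum, Fintype.card_sum, card_subtype_ne_zero, card_subtype_ne_zero,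
    Fintype.card_fin]
  omega

/-- A path whose two ends carry `p / 2` and `(p + 1) / 2` pendant vertices is `treeT1 n p`. -/
theorem nonempty_iso_treeT1 [Fintype V] [DecidableEq V] {n p : ℕ} (h : p + 2 ≤ n)
    (hn : Fintype.card V = n) {L : Finset V} {π : V → V} {f : V → ℕ}
    (hπ : ∀ l ∈ L, π l ∉ L ∧ ∀ x, G.Adj l x ↔ x = π l) (hLp : L.card = p)
    (hf : IsNumbering G PathRel Lᶜ f) {y z : V} (hy : y ∉ L) (hz : z ∉ L) (hfy : f y = 0)
    (hfz : f z = n - p - 1) (hwy : {l ∈ L | π l = y}.card = p / 2)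
    (hwz : {l ∈ L | π l = z}.card = (p + 1) / 2) : Nonempty (G ≃g treeT1 n p h) := by
  have hc : Lᶜ.card = n - p := by rw [Finset.card_compl, hLp, hn]
  have hex : ∀ i : Fin (n - p), ∃ x, x ∉ L ∧ f x = i := fun i => by
    obtain ⟨x, hx, hfx⟩ := hf.exists_eq (i := i) (by rw [hc]; exact i.2)
    exact ⟨x, Finset.mem_compl.1 hx, hfx⟩
  choose u hu hfu using hex
  obtain ⟨a⟩ : Nonempty ({w : Fin (p / 2 + 1) // w ≠ 0} ≃ {l // l ∈ ({l ∈ L | π l = y})}) :=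
    Fintype.card_eq.1 (by rw [card_subtype_ne_zero, Fintype.card_coe, hwy])
  obtain ⟨b⟩ : Nonempty ({w : Fin ((p + 1) / 2 + 1) // w ≠ 0} ≃
      {l // l ∈ ({l ∈ L | π l = z})}) :=
    Fintype.card_eq.1 (by rw [card_subtype_ne_zero, Fintype.card_coe, hwz])
  have ha : ∀ i, (a i : V) ∈ L ∧ π (a i) = y := fun i => Finset.mem_filter.1 (a i).2
  have hb : ∀ i, (b i : V) ∈ L ∧ π (b i) = z := fun i => Finset.mem_filter.1 (b i).2
  have hyz : y ≠ z := by
    rintro rfl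
    omega
  have huy : ∀ i, u i = y ↔ i.1 = 0 := fun i => by
    rw [← hfu i, ← hfy]
    exact ⟨congrArg f, fun h => hf.injOn (Finset.mem_coe.2 (Finset.mem_compl.2 (hu i)))
      (Finset.mem_coe.2 (Finset.mem_compl.2 hy)) h⟩
  have huz : ∀ i, u i = z ↔ i.1 = n - p - 1 := fun i => by
    rw [← hfu i, ← hfz]
    exact ⟨congrArg f, fun h => hf.injOn (Finset.mem_coe.2 (Finset.mem_compl.2 (hu i)))
      (Finset.mem_coe.2 (Finset.mem_compl.2 hz)) h⟩
  have hinj : Function.Injective (Sum.elim (Sum.elim u fun i => (a i : V)) fun i => (b i : V)) := by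
    rintro ((i | i) | i) ((j | j) | j) hij
    all_goals simp only [Sum.elim_inl, Sum.elim_inr] at hij
    · congr 2
      exact Fin.ext (by rw [← hfu i, ← hfu j, hij])
    · exact absurd (ha j).1 (hij ▸ hu i)
    · exact absurd (hb j).1 (hij ▸ hu i)
    · exact absurd (ha i).1 (hij ▸ hu j)
    · congr 2
      exact a.injective (Subtype.ext hij)
    · exact absurd ((ha i).2.symm.trans ((congrArg π hij).trans (hb j).2)) hyz
    · exact absurd (hb i).1 (hij ▸ hu j)
    · exact absurd ((ha j).2.symm.trans ((congrArg π hij.symm).trans (hb i).2)) hyz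
    · congr 1
      exact b.injective (Subtype.ext hij)
  have hLL : ∀ l ∈ L, ∀ x ∈ L, ¬ G.Adj l x := fun l hl x hx hlx =>
    (hπ l hl).1 (((hπ l hl).2 x).1 hlx ▸ hx)
  have hau : ∀ i j, G.Adj (a i) (u j) ↔ j.1 = 0 := fun i j => by
    rw [(hπ _ (ha i).1).2, (ha i).2, huy]
  have hbu : ∀ i j, G.Adj (b i) (u j) ↔ j.1 = n - p - 1 := fun i j => by
    rw [(hπ _ (hb i).1).2, (hb i).2, huz]
  have huu : ∀ i j, G.Adj (u i) (u j) ↔ PathRel i j := fun i j => by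
    rw [hf.adj_iff _ (Finset.mem_compl.2 (hu i)) _ (Finset.mem_compl.2 (hu j)), hfu, hfu]
  refine ⟨SimpleGraph.Iso.symm ⟨Equiv.ofBijective _ ((Fintype.bijective_iff_injective_and_card _).2
    ⟨hinj, (card_treeT1 n p h).trans hn.symm⟩), ?_⟩⟩
  rintro ((i | i) | i) ((j | j) | j)
  all_goals simp only [Equiv.ofBijective_apply, Sum.elim_inl, Sum.elim_inr, identifyVertices]
  · rw [huu, SimpleGraph.pathGraph_adj, PathRel]
  · rw [G.adj_comm, hau]
    simp [SimpleGraph.starGraph_adj, Fin.ext_iff, eq_comm, j.2]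
  · rw [G.adj_comm, hbu]
    simp [SimpleGraph.starGraph_adj, Fin.ext_iff, eq_comm, j.2]
  · rw [hau]
    simp [SimpleGraph.starGraph_adj, Fin.ext_iff, eq_comm, i.2]
  · simp [hLL _ (ha i).1 _ (ha j).1, SimpleGraph.starGraph_adj, i.2, j.2]
  · simp [hLL _ (ha i).1 _ (hb j).1]
  · rw [hbu]
    simp [SimpleGraph.starGraph_adj, Fin.ext_iff, eq_comm, i.2]
  · simp [hLL _ (hb i).1 _ (ha j).1]
  · simp [hLL _ (hb i).1 _ (hb j).1, SimpleGraph.starGraph_adj, i.2, j.2]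

theorem two_mul_numConnInduced_treeT1 (n p k : ℕ) (h : p + 2 ≤ n) (hk : n = p + k + 1) :
    2 * numConnInduced (treeT1 n p h) + k = 2 * p +
      (2 * 2 ^ p + 2 * k * (2 ^ (p / 2) + 2 ^ ((p + 1) / 2)) + k * k) := by
  classical
  let core : Fin (n - p) ↪ TreeT1Vertex n p :=
    ⟨fun i => Sum.inl (Sum.inl i), Sum.inl_injective.comp Sum.inl_injective⟩
  let la : {w : Fin (p / 2 + 1) // w ≠ 0} ↪ TreeT1Vertex n p :=
    ⟨fun i => Sum.inl (Sum.inr i), Sum.inl_injective.comp Sum.inr_injective⟩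
  let lb : {w : Fin ((p + 1) / 2 + 1) // w ≠ 0} ↪ TreeT1Vertex n p :=
    ⟨fun i => Sum.inr i, Sum.inr_injective⟩
  let y : TreeT1Vertex n p := core ⟨0, by omega⟩
  let z : TreeT1Vertex n p := core ⟨n - p - 1, by omega⟩
  let π : TreeT1Vertex n p → TreeT1Vertex n p := Sum.elim (Sum.elim core fun _ => y) fun _ => z
  let f : TreeT1Vertex n p → ℕ := Sum.elim (Sum.elim (fun i => i.1) fun _ => 0) fun _ => 0
  let L : Finset (TreeT1Vertex n p) := (Finset.univ.map core)ᶜ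
  have hcore : ∀ i, core i ∉ L := fun i => by simp [L]
  have hla : ∀ i, la i ∈ L := fun i => by
    simp only [L, Finset.mem_compl, Finset.mem_map, not_exists, not_and]
    exact fun j _ hj => by cases hj
  have hlb : ∀ i, lb i ∈ L := fun i => by
    simp only [L, Finset.mem_compl, Finset.mem_map, not_exists, not_and]
    exact fun j _ hj => by cases hj
  have hyz : y ≠ z := fun h' => by
    have := congrArg Fin.val (core.injective h')
    simp only at this
    omega
  have hcompl : Lᶜ = Finset.univ.map core := compl_compl _
  have hLc : Lᶜ.card = k + 1 := by
    rw [hcompl, Finset.card_map, Finset.card_univ, Fintype.card_fin]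
    omega
  have hL : L.card = p := by
    have h1 := Finset.card_add_card_compl L
    rw [hLc, card_treeT1 n p h] at h1
    omega
  have hπ : ∀ l ∈ L, π l ∉ L ∧ ∀ x, (treeT1 n p h).Adj l x ↔ x = π l := by
    rintro ((i | i) | i) hl
    · exact absurd hl (hcore i)
    · refine ⟨hcore _, ?_⟩
      rintro ((j | j) | j)
      · change (j = _ ∧ _) ↔ core j = core _
        rw [core.injective.eq_iff]
        exact and_iff_left (SimpleGraph.starGraph_adj_center_iff.2 (Ne.symm i.2))
      · exact iff_of_false (fun h' => (SimpleGraph.starGraph_adj.1 h').2.elim i.2 j.2)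
          (fun h' => by cases h')
      · exact iff_of_false (fun h' => by cases h'.1) (fun h' => by cases h')
    · refine ⟨hcore _, ?_⟩
      rintro ((j | j) | j)
      · change (Sum.inl j = Sum.inl _ ∧ _) ↔ core j = core _
        rw [core.injective.eq_iff, Sum.inl_injective.eq_iff]
        exact and_iff_left (SimpleGraph.starGraph_adj_center_iff.2 (Ne.symm i.2))
      · exact iff_of_false (fun h' => by cases h'.1) (fun h' => by cases h')
      · exact iff_of_false (fun h' => (SimpleGraph.starGraph_adj.1 h').2.elim i.2 j.2)
          (fun h' => by cases h')
  have hf : IsNumbering (treeT1 n p h) PathRel Lᶜ f := by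
    rw [hcompl]
    refine ⟨?_, ?_, ?_⟩
    · intro x hx
      obtain ⟨i, -, rfl⟩ := Finset.mem_map.1 hx
      rw [Finset.card_map, Finset.card_univ, Fintype.card_fin]
      exact i.2
    · rintro x hx x' hx' hxx'
      obtain ⟨i, -, rfl⟩ := Finset.mem_map.1 (Finset.mem_coe.1 hx)
      obtain ⟨j, -, rfl⟩ := Finset.mem_map.1 (Finset.mem_coe.1 hx')
      exact congrArg core (Fin.ext hxx')
    · intro x hx x' hx'
      obtain ⟨i, -, rfl⟩ := Finset.mem_map.1 hx
      obtain ⟨j, -, rfl⟩ := Finset.mem_map.1 hx'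
      exact SimpleGraph.pathGraph_adj
  have hwy : {l ∈ L | π l = y}.card = p / 2 := by
    refine Eq.trans ?_ (card_subtype_ne_zero (p / 2))
    rw [← Finset.card_univ, ← Finset.card_map la]
    congr 1
    ext x
    rw [Finset.mem_filter, Finset.mem_map]
    constructor
    · rcases x with (i | i) | i
      · exact fun h' => absurd h'.1 (hcore i)
      · exact fun _ => ⟨i, Finset.mem_univ _, rfl⟩
      · exact fun h' => absurd h'.2 hyz.symm
    · rintro ⟨i, -, rfl⟩
      exact ⟨hla i, rfl⟩
  have hwz : {l ∈ L | π l = z}.card = (p + 1) / 2 := by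
    refine Eq.trans ?_ (card_subtype_ne_zero ((p + 1) / 2))
    rw [← Finset.card_univ, ← Finset.card_map lb]
    congr 1
    ext x
    rw [Finset.mem_filter, Finset.mem_map]
    constructor
    · rcases x with (i | i) | i
      · exact fun h' => absurd h'.1 (hcore i)
      · exact fun h' => absurd h'.2 hyz
      · exact fun _ => ⟨i, Finset.mem_univ _, rfl⟩
    · rintro ⟨i, -, rfl⟩
      exact ⟨hlb i, rfl⟩
  have key := hf.two_mul_wSum (fun x => {l ∈ L | π l = x}.card) (y := y) (z := z) hLc (by omega)
    (Finset.mem_compl.2 (hcore _)) (Finset.mem_compl.2 (hcore _)) rfl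
    (by change n - p - 1 = k; omega)
    (fun x hx hx0 hxk => by
      rw [Finset.card_eq_zero, Finset.filter_eq_empty_iff]
      rintro ((i | i) | i) hl rfl
      · exact hcore i hl
      · exact hx0 rfl
      · apply hxk
        change n - p - 1 = k
        omega)
  simp only [hwy, hwz] at key
  rw [show p / 2 + (p + 1) / 2 = p by omega] at key
  rw [numConnInduced_eq_card, card_connSets_of_pendant hπ, hL]
  omega

end Iso

end ConnInduced

/-! ### Graphs with one and with several pendant vertices -/

namespace ConnInduced

variable {V : Type*} [Fintype V] [DecidableEq V] {G : SimpleGraph V} {L : Finset V}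

/-- The case of one pendant vertex `v`, attached to `r`: the bound for `V \ {v}` and `r` applies,
since all other vertices have two neighbours different from `v`. -/
theorem le_numConnInduced_of_one_pendant (hG : G.Connected) (h4 : 4 ≤ Fintype.card V)
    (hL : ∀ l, l ∈ L ↔ ∃! x, G.Adj l x) (hL1 : L.card = 1) :
    Fintype.card V * Fintype.card V + 3 * Fintype.card V ≤ 2 * numConnInduced G + 4 ∧
      (2 * numConnInduced G + 4 ≤ Fintype.card V * Fintype.card V + 3 * Fintype.card V →
        Nonempty (G ≃g trianglePath (Fintype.card V) (by omega))) := by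
  obtain ⟨π, hπ⟩ := exists_pendant_neighbor hG (by omega) hL
  obtain ⟨v, rfl⟩ := Finset.card_eq_one.1 hL1
  obtain ⟨hr, hv⟩ := hπ v (Finset.mem_singleton_self v)
  rw [Finset.mem_singleton] at hr
  have hvr : G.Adj v (π v) := (hv _).2 rfl
  have hV := isConn_univ hG
  have hleaf : ∀ x ∈ Finset.univ, G.Adj v x → x = π v := fun x _ => (hv x).1
  have hrS : π v ∈ Finset.univ.erase v := Finset.mem_erase.2 ⟨hr, Finset.mem_univ _⟩
  have hS := hV.erase_leaf hleaf ⟨_, hrS⟩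
  have hc : (Finset.univ.erase v).card + 1 = Fintype.card V := by
    rw [Finset.card_erase_add_one (Finset.mem_univ v), Finset.card_univ]
  have hdeg : ∀ x ∈ Finset.univ.erase v, x ≠ π v →
      ∃ a ∈ Finset.univ.erase v, ∃ b ∈ Finset.univ.erase v, a ≠ b ∧ G.Adj x a ∧ G.Adj x b := by
    intro x hx hxr
    obtain ⟨a, -, hxa⟩ := hV.exists_adj_mem (Finset.mem_univ x) (by rw [Finset.card_univ]; omega)
    have hxL : ¬ ∃! y, G.Adj x y := fun h =>
      (Finset.mem_erase.1 hx).1 (Finset.mem_singleton.1 ((hL x).2 h))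
    obtain ⟨b, hxb, hba⟩ : ∃ b, G.Adj x b ∧ b ≠ a := by
      by_contra! hcon
      exact hxL ⟨a, hxa, hcon⟩
    have hne : ∀ y, G.Adj x y → y ∈ Finset.univ.erase v := fun y hxy =>
      Finset.mem_erase.2 ⟨by rintro rfl; exact hxr ((hv x).1 hxy.symm), Finset.mem_univ _⟩
    exact ⟨a, hne a hxa, b, hne b hxb, hba.symm, hxa, hxb⟩
  obtain ⟨-, h1, h2⟩ := card_connSets_add_card_connSetsAt hS hrS (by omega) hdeg
  have h5 := card_connSetsAt_leaf (Finset.mem_univ v) (Finset.mem_univ _) hvr hleaf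
  have h6 := card_connSets_eq_erase_add (G := G) (S := Finset.univ) v
  rw [numConnInduced_eq_card]
  constructor
  · nlinarith
  · intro h
    obtain ⟨f, hf, hfr⟩ := h2 (by nlinarith)
    have hg := hf.update (Finset.mem_univ v) hrS (by rw [Finset.card_univ]; omega) hvr hleaf
      (fun i hi => (tadpoleRel_last (by rw [Finset.card_univ]; omega) i hi).1)
      (fun i hi => (tadpoleRel_last (by rw [Finset.card_univ]; omega) i hi).2)
    exact hg.nonempty_iso (isNumbering_trianglePath _ (by omega))
      (card_trianglePath _ (by omega)).symm

/-- The lower bound for `p` pendant vertices; equality forces the vertices that are not pendant to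
form a path with all pendant vertices distributed evenly to its two ends. -/
theorem le_numConnInduced_of_pendant (hG : G.Connected) {n p k : ℕ} (hn : Fintype.card V = n)
    (hk : n = p + k + 1) (hk1 : 1 ≤ k) (hp : 1 ≤ p) (hL : ∀ l, l ∈ L ↔ ∃! x, G.Adj l x)
    (hLp : L.card = p) :
    2 * p + (2 * 2 ^ p + 2 * k * (2 ^ (p / 2) + 2 ^ ((p + 1) / 2)) + k * k) ≤
        2 * numConnInduced G + k ∧
      (2 * numConnInduced G + k ≤
          2 * p + (2 * 2 ^ p + 2 * k * (2 ^ (p / 2) + 2 ^ ((p + 1) / 2)) + k * k) →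
        Nonempty (G ≃g treeT1 n p (by omega))) := by
  obtain ⟨π, hπ⟩ := exists_pendant_neighbor hG (by omega) hL
  have hLc : Lᶜ.card = k + 1 := by
    rw [Finset.card_compl, hn, hLp]
    omega
  have hLc' : Lᶜ = Finset.univ \ L := Finset.compl_eq_univ_sdiff L
  have hS : IsConn G Lᶜ := by
    rw [hLc']
    refine (isConn_univ hG).sdiff_pendant hπ ?_
    rw [← hLc', ← Finset.card_pos]
    omega
  have hN := card_connSets_of_pendant hπ
  rw [← numConnInduced_eq_card, hLp] at hN
  have hq : ∑ x ∈ Lᶜ, {l ∈ L | π l = x}.card = p := by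
    rw [← Finset.card_eq_sum_card_fiberwise (f := π) (s := L) (t := Lᶜ)
      (fun l hl => Finset.mem_coe.2 (Finset.mem_compl.2 (hπ l hl).1)), hLp]
  have hle := le_two_mul_wSum _ hS hq hLc
  refine ⟨by omega, fun h => ?_⟩
  obtain ⟨f, hf, hw⟩ := exists_isNumbering_of_wSum_le _ hS hq hLc (by omega)
  obtain ⟨y, hy, hfy⟩ := hf.exists_eq (i := 0) (by omega)
  obtain ⟨z, hz, hfz⟩ := hf.exists_eq (i := k) (by omega)
  have hyz : y ≠ z := by
    rintro rfl
    omega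
  have hyL := Finset.mem_compl.1 hy
  have hzL := Finset.mem_compl.1 hz
  have hexact := hf.two_mul_wSum _ hLc hk1 hy hz hfy hfz hw
  have hsum : {l ∈ L | π l = y}.card + {l ∈ L | π l = z}.card = p := by
    rw [← hq, ← Finset.sum_pair (f := fun x => {l ∈ L | π l = x}.card) hyz]
    refine Finset.sum_subset (Finset.insert_subset hy (Finset.singleton_subset_iff.2 hz)) ?_
    intro x hx hxyz
    simp only [Finset.mem_insert, Finset.mem_singleton, not_or] at hxyz
    exact hw x hx (fun h => hxyz.1 (hf.injOn hx hy (h.trans hfy.symm)))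
      (fun h => hxyz.2 (hf.injOn hx hz (h.trans hfz.symm)))
  have hbal : 2 ^ {l ∈ L | π l = y}.card + 2 ^ {l ∈ L | π l = z}.card =
      2 ^ (p / 2) + 2 ^ ((p + 1) / 2) := by
    refine le_antisymm ?_ (two_pow_balanced hsum).1
    rw [hsum] at hexact
    nlinarith
  rcases (two_pow_balanced hsum).2 hbal with hb | hb
  · exact nonempty_iso_treeT1 _ hn hπ hLp hf hyL hzL hfy (by omega) hb (by omega)
  · exact nonempty_iso_treeT1 _ hn hπ hLp hf.reverse hzL hyL
      (show Lᶜ.card - 1 - f z = 0 by omega) (show Lᶜ.card - 1 - f y = n - p - 1 by omega) hb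
      (by omega)

end ConnInduced

open ConnInduced in
theorem theorem3p3 {V : Type*} [Fintype V] (G : SimpleGraph V) [DecidableRel G.Adj] (n p : ℕ)
    (hG : G.Connected) (hn : Fintype.card V = n) (hp : numPendant G = p)
    (hn4 : 4 ≤ n) (hp1 : 1 ≤ p) (hpn : p + 2 ≤ n) :
    (p = 1 →
      ((n : ℚ) ^ 2 + 3 * n - 4) / 2 ≤ (numConnInduced G : ℚ) ∧
      ((numConnInduced G : ℚ) = ((n : ℚ) ^ 2 + 3 * n - 4) / 2 ↔
        Nonempty (G ≃g trianglePath n (by omega)))) ∧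
    (p ≠ 1 →
      (2 : ℚ) ^ p + ((n : ℚ) - p - 1) * ((2 : ℚ) ^ (p / 2) + (2 : ℚ) ^ ((p + 1) / 2)) + p
          + ((n : ℚ) - p - 1) * ((n : ℚ) - p - 2) / 2 ≤ (numConnInduced G : ℚ) ∧
      ((numConnInduced G : ℚ) =
          (2 : ℚ) ^ p + ((n : ℚ) - p - 1) * ((2 : ℚ) ^ (p / 2) + (2 : ℚ) ^ ((p + 1) / 2)) + p
            + ((n : ℚ) - p - 1) * ((n : ℚ) - p - 2) / 2 ↔
        Nonempty (G ≃g treeT1 n p hpn))) := by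
  classical
  have hL : ∀ l, l ∈ Finset.univ.filter (fun v => G.degree v = 1) ↔ ∃! x, G.Adj l x := fun l => by
    rw [Finset.mem_filter, SimpleGraph.degree_eq_one_iff_existsUnique_adj]
    exact and_iff_right (Finset.mem_univ l)
  rw [numPendant] at hp
  constructor
  · rintro rfl
    subst hn
    obtain ⟨h1, h2⟩ := le_numConnInduced_of_one_pendant hG hn4 hL hp
    have h1' : (Fintype.card V * Fintype.card V + 3 * Fintype.card V : ℚ) ≤
        2 * numConnInduced G + 4 := by exact_mod_cast h1
    refine ⟨by linarith, fun h => h2 ?_, fun ⟨e⟩ => ?_⟩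
    · have : (2 * numConnInduced G + 4 : ℚ) ≤
          Fintype.card V * Fintype.card V + 3 * Fintype.card V := by linarith
      exact_mod_cast this
    · have h3 := two_mul_numConnInduced_trianglePath (Fintype.card V) (by omega)
      rw [← numConnInduced_congr e] at h3
      have h3' : (2 * numConnInduced G + 4 : ℚ) =
        Fintype.card V * Fintype.card V + 3 * Fintype.card V := by exact_mod_cast h3
      linarith
  · intro _
    -- `k` is the number of edges of the path `P_{n-p}`.
    obtain ⟨k, hk⟩ : ∃ k, n = p + k + 1 := ⟨n - p - 1, by omega⟩
    obtain ⟨h1, h2⟩ := le_numConnInduced_of_pendant hG hn hk (by omega) hp1 hL hp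
    have hkQ : (n : ℚ) = p + k + 1 := by exact_mod_cast hk
    have h1' : (2 * p + (2 * 2 ^ p + 2 * k * (2 ^ (p / 2) + 2 ^ ((p + 1) / 2)) + k * k) : ℚ) ≤
        2 * numConnInduced G + k := by exact_mod_cast h1
    have e1 : (n : ℚ) - p - 1 = k := by rw [hkQ]; ring
    have e2 : (n : ℚ) - p - 2 = k - 1 := by rw [hkQ]; ring
    rw [e1, e2]
    refine ⟨by linarith, fun h => h2 ?_, fun ⟨e⟩ => ?_⟩
    · have : (2 * numConnInduced G + k : ℚ) ≤
          2 * p + (2 * 2 ^ p + 2 * k * (2 ^ (p / 2) + 2 ^ ((p + 1) / 2)) + k * k) := by linarith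
      exact_mod_cast this
    · have h3 := two_mul_numConnInduced_treeT1 n p k hpn hk
      rw [← numConnInduced_congr e] at h3
      have h3' : (2 * numConnInduced G + k : ℚ) =
          2 * p + (2 * 2 ^ p + 2 * k * (2 ^ (p / 2) + 2 ^ ((p + 1) / 2)) + k * k) := by
        exact_mod_cast h3
      linarith
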